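/- All graphs are finite, simple and undirected. For a graph $G$ on $n$ vertices, two disjoint vertex sets are *impure* towards each other if they are neither completely adjacent nor completely non-adjacent. A *contraction sequence* of $G$ is a sequence $\mathcal P_1,\dots,\mathcal P_n$ of partitions of $V(G)$ where $\mathcal P_1$ is the partition into singletons, $\mathcal P_n$ has one part, and each $\mathcal P_{t}$ with $t>1$ arises from $\mathcal P_{t-1}$ by merging two distinct parts. Its *width* is the maximum, over all $t$ and all $P\in\mathcal P_t$, of the number of parts of $\mathcal P_t$ other than $P$ that are impure towards $P$, and the *twin-width* of $G$ is the minimum width of a contraction sequence of $G$. For a first-order formula $\varphi(\bar x,\bar y)$ in the language of graphs (adjacency and equality), whose free variables are partitioned into finite tuples $\bar x$ and $\bar y$, and for $A\subseteq V(G)$, let $$S^{\varphi}(A)=\bigl\{\{\bar a\in A^{\bar x} : G\models\varphi(\bar a,\bar b)\} : \bar b\in V(G)^{\bar y}\bigr\}.$$ **Theorem.** For every $d\in\mathbb N$ and every first-order formula $\varphi(\bar x,\bar y)$ there is a constant $C=C(d,\varphi)$ such that for every graph $G$ of twin-width at most $d$ and every nonempty $A\subseteq V(G)$, $$|S^{\varphi}(A)|\le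 C\cdot |A|^{|\bar y|}.$$ The bound is asymptotically optimal, already for edgeless graphs (whose twin-width is $0$): for all finite tuples of variables $\bar x,\bar y$ with $\bar x$ nonempty there are a first-order formula $\varphi(\bar x,\bar y)$ and a constant $c>0$ such that $|S^{\varphi}(A)|\ge c\cdot|A|^{|\bar y|}$ for every edgeless graph $G$ and every $A\subseteq V(G)$. -/

import Mathlib

open FirstOrder

universe u v w

namespace TwinWidth

/-- The pair `A, B` is complete: every vertex of `A` is adjacent to every vertex of `B`. -/
def IsComplete {V : Type u} (G : SimpleGraph V) (A B : Finset V) : Prop :=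
  ∀ a ∈ A, ∀ b ∈ B, G.Adj a b

/-- The pair `A, B` is anti-complete: there is no edge between `A` and `B`. -/
def IsAnticomplete {V : Type u} (G : SimpleGraph V) (A B : Finset V) : Prop :=
  ∀ a ∈ A, ∀ b ∈ B, ¬ G.Adj a b

/-- The pair `A, B` is impure: neither complete nor anti-complete. -/
def IsImpure {V : Type u} (G : SimpleGraph V) (A B : Finset V) : Prop :=
  ¬ IsComplete G A B ∧ ¬ IsAnticomplete G A B

/-- The impurity graph of the quotient trigraph `G / P`: its vertices are the parts of `P`, and
two distinct parts are adjacent when they are impure towards each other in `G`. -/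
def impurityGraph {V : Type u} [Fintype V] [DecidableEq V] (G : SimpleGraph V)
    (P : Finpartition (Finset.univ : Finset V)) : SimpleGraph {A : Finset V // A ∈ P.parts} where
  Adj A B := A ≠ B ∧ IsImpure G A.1 B.1
  symm := ⟨fun _ _ h => ⟨h.1.symm,
    fun hc => h.2.1 fun a ha b hb => (hc b hb a ha).symm,
    fun hc => h.2.2 fun a ha b hb hab => hc b hb a ha hab.symm⟩⟩
  loopless := ⟨fun _ h => h.1 rfl⟩

/-- A contraction sequence on a vertex set with `n` elements: partitions indexed by
`0, …, n - 1`, the first one into singletons, the last one with a single part, each obtained from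
the previous one by merging two distinct parts. (For `n = 0` it is the empty sequence.) -/
structure ContractionSequence (V : Type u) [Fintype V] [DecidableEq V] where
  partition : Fin (Fintype.card V) → Finpartition (Finset.univ : Finset V)
  first : ∀ h : 0 < Fintype.card V, partition ⟨0, h⟩ = ⊥
  last : ∀ t : Fin (Fintype.card V), (t : ℕ) + 1 = Fintype.card V →
    (partition t).parts = {Finset.univ}
  step : ∀ (t : ℕ) (h : t + 1 < Fintype.card V),
    ∃ A ∈ (partition ⟨t, Nat.lt_of_succ_lt h⟩).parts,
    ∃ B ∈ (partition ⟨t, Nat.lt_of_succ_lt h⟩).parts,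
      A ≠ B ∧ (partition ⟨t + 1, h⟩).parts =
        insert (A ∪ B) (((partition ⟨t, Nat.lt_of_succ_lt h⟩).parts.erase A).erase B)

open scoped Classical in
/-- The width of a contraction sequence: the maximum degree occurring in the impurity graphs of
its partitions. -/
noncomputable def ContractionSequence.width {V : Type u} [Fintype V] [DecidableEq V]
    (S : ContractionSequence V) (G : SimpleGraph V) : ℕ :=
  Finset.univ.sup fun t => (impurityGraph G (S.partition t)).maxDegree

/-- The twin-width of a finite graph: the minimum width of a contraction sequence. -/
noncomputable def twinWidth {V : Type u} [Fintype V] [DecidableEq V] (G : SimpleGraph V) : ℕ∞ :=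
  ⨅ S : ContractionSequence V, (S.width G : ℕ∞)

/-- For a first-order formula `φ(x, y)` in the language of graphs, with the variables `x` indexed
by `α` and the variables `y` indexed by `β`, the set `{a ∈ A^x : G ⊨ φ(a, b)}`. -/
def definedSet {α : Type v} {β : Type w} {V : Type u} (G : SimpleGraph V)
    (φ : Language.graph.Formula (α ⊕ β)) (A : Finset V) (b : β → V) : Set (α → V) :=
  {a | (∀ i, a i ∈ A) ∧
    @Language.Formula.Realize Language.graph V G.structure (α ⊕ β) φ (Sum.elim a b)}

/-- The Stone space: all sets `{a ∈ A^x : G ⊨ φ(a, b)}` for `b ∈ V(G)^y`. -/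
def stoneSpace {α : Type v} {β : Type w} {V : Type u} (G : SimpleGraph V)
    (φ : Language.graph.Formula (α ⊕ β)) (A : Finset V) : Set (Set (α → V)) :=
  Set.range fun b : β → V => definedSet G φ A b

end TwinWidth

/-! The set defined by a tuple `b` is fixed by the outcome of a game with boundedly many rounds on
positions made of `b` and tuples from `A` (`exists_realize_iff`). So it suffices to count how `b`
can look over `A` in that game. The game is refined by colouring each vertex with its part at time
`t` of a contraction sequence. Between parts that are not impure, colours decide adjacency, so
positions far apart in the impurity graph do not interact (`Winning.union`, in the spirit of Gaifman
locality). As that graph has bounded degree, tuples with prescribed colours fall into boundedly many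
game classes (`exists_code`).

Now let time run. At time 0 colours are injective and every `b` is `Simple` over the empty subtuple:
adding it to a winning position over `A` costs nothing. Suppose the entries in `J` are known up to
`Similar` and the others are simple over them. Simplicity can be lost only at an event, when tuples
over `A` and the `J`-entries become equivalent (`Simple.isEvent`), and only by a merge near some
entry `b i` with `i` outside `J` (`Simple.of_far`). Just before, `b i` has one of boundedly many
colours, and for each colour simplicity leaves boundedly many traces on `insert i J`
(`exists_representatives`). So `i` joins `J`, at the price of choosing an event; after `|y|` rounds
all of `b` is described (`exists_descriptions`).

It remains to see that events over a set `B` are `O(|B|)` in number (`exists_cover_events`). A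
position that turns from losing to winning contains a losing part inside a small ball
(`exists_local_of_not_winning`). Follow this part until a merge brings a new element of `B` into the
colour class of one of its entries, or until all colours agree. There are at most `|B| + 1` such
moments. At that moment the part lies near the merged class, so its colours take boundedly many
values; the tuples with these colours had boundedly many game classes, and these can coarsen only
boundedly often (`exists_cover_of_stable`).

For the lower bound, the formula saying that one fixed `x`-variable equals some `y`-variable
recovers the set of entries of `b`. -/

namespace TwinWidth

/-! ### Distance between colour classes and the colour-preserving Ehrenfeucht–Fraïssé game -/

section Game

variable {V : Type u} {ι : Type v} {κ : Type w} {G : SimpleGraph V} {p p' : V → ι}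

/-- Two vertices are linked when their colour classes coincide or are impure. -/
def Linked (G : SimpleGraph V) (p : V → ι) (x y : V) : Prop :=
  p x = p y ∨ ∃ x₁ x₂ y₁ y₂, p x₁ = p x ∧ p x₂ = p x ∧ p y₁ = p y ∧ p y₂ = p y ∧
    G.Adj x₁ y₁ ∧ ¬ G.Adj x₂ y₂

/-- The colour classes of the two vertices are at distance at most `n` in the impurity graph. -/
def Near (G : SimpleGraph V) (p : V → ι) : ℕ → V → V → Prop
  | 0, x, y => p x = p y
  | n + 1, x, y => ∃ z, Near G p n x z ∧ Linked G p z y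

lemma Linked.symm {x y : V} (h : Linked G p x y) : Linked G p y x := by
  rcases h with h | ⟨x₁, x₂, y₁, y₂, h₁, h₂, h₃, h₄, h₅, h₆⟩
  · exact Or.inl h.symm
  · exact Or.inr ⟨y₁, y₂, x₁, x₂, h₃, h₄, h₁, h₂, h₅.symm, fun h => h₆ h.symm⟩

lemma Linked.congr {x y x' y' : V} (h : Linked G p x y) (hx : p x = p x') (hy : p y = p y') :
    Linked G p x' y' := by
  unfold Linked at *
  rwa [← hx, ← hy]

lemma Linked.coarsen (hp : ∀ x y, p x = p y → p' x = p' y) {x y : V} (h : Linked G p x y) :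
    Linked G p' x y := by
  rcases h with h | ⟨x₁, x₂, y₁, y₂, h₁, h₂, h₃, h₄, h₅, h₆⟩
  · exact Or.inl (hp _ _ h)
  · exact Or.inr ⟨x₁, x₂, y₁, y₂, hp _ _ h₁, hp _ _ h₂, hp _ _ h₃, hp _ _ h₄, h₅, h₆⟩

lemma Near.congr_right {n : ℕ} {x y y' : V} (h : Near G p n x y) (hy : p y = p y') :
    Near G p n x y' := by
  cases n with
  | zero => exact Eq.trans h hy
  | succ n =>
    obtain ⟨z, h₁, h₂⟩ := h
    exact ⟨z, h₁, h₂.congr rfl hy⟩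

lemma Near.congr_left {n : ℕ} {x x' y : V} (h : Near G p n x y) (hx : p x = p x') :
    Near G p n x' y := by
  induction n generalizing y with
  | zero => exact hx.symm.trans h
  | succ n ih =>
    obtain ⟨z, h₁, h₂⟩ := h
    exact ⟨z, ih h₁, h₂⟩

lemma Near.trans {n m : ℕ} {x y z : V} (h : Near G p n x y) (h' : Near G p m y z) :
    Near G p (n + m) x z := by
  induction m generalizing z with
  | zero => exact h.congr_right h'
  | succ m ih =>
    obtain ⟨a, h₁, h₂⟩ := h'
    exact ⟨a, ih h₁, h₂⟩

lemma near_self (n : ℕ) {x y : V} (h : p x = p y) : Near G p n x y := by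
  induction n with
  | zero => exact h
  | succ n ih => exact ⟨y, ih, Or.inl rfl⟩

lemma Near.mono {n m : ℕ} (hnm : n ≤ m) {x y : V} (h : Near G p n x y) : Near G p m x y := by
  obtain ⟨k, rfl⟩ := Nat.exists_eq_add_of_le hnm
  exact h.trans (near_self k rfl)

lemma Near.symm {n : ℕ} {x y : V} (h : Near G p n x y) : Near G p n y x := by
  induction n generalizing y with
  | zero => exact Eq.symm h
  | succ n ih =>
    obtain ⟨z, h₁, h₂⟩ := h
    rw [add_comm]
    exact Near.trans (n := 1) ⟨y, rfl, h₂.symm⟩ (ih h₁)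

lemma Near.coarsen (hp : ∀ x y, p x = p y → p' x = p' y) {n : ℕ} {x y : V}
    (h : Near G p n x y) : Near G p' n x y := by
  induction n generalizing y with
  | zero => exact hp _ _ h
  | succ n ih =>
    obtain ⟨z, h₁, h₂⟩ := h
    exact ⟨z, ih h₁, h₂.coarsen hp⟩

/-- Every colour class is linked to at most `d + 1` colour classes, itself included. -/
def BoundedLinks (G : SimpleGraph V) (p : V → ι) (d : ℕ) : Prop :=
  ∀ x, ∃ F : Finset ι, F.card ≤ d + 1 ∧ ∀ y, Linked G p x y → p y ∈ F

lemma BoundedLinks.ball {d : ℕ} (h : BoundedLinks G p d) (n : ℕ) (x : V) :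
    ∃ F : Finset ι, F.card ≤ (d + 1) ^ n ∧ ∀ y, Near G p n x y → p y ∈ F := by
  classical
  induction n with
  | zero => exact ⟨{p x}, by simp, fun y hy => by simpa using Eq.symm hy⟩
  | succ n ih =>
    obtain ⟨F, hF, hF'⟩ := ih
    have key : ∀ i : ι, ∃ H : Finset ι, H.card ≤ d + 1 ∧
        ∀ z y, p z = i → Linked G p z y → p y ∈ H := by
      intro i
      by_cases hi : ∃ z, p z = i
      · obtain ⟨z, rfl⟩ := hi
        obtain ⟨H, hH, hH'⟩ := h z
        exact ⟨H, hH, fun z' y hz hy => hH' y (hy.congr hz rfl)⟩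
      · exact ⟨∅, by simp, fun z y hz => absurd ⟨z, hz⟩ hi⟩
    choose H hH hH' using key
    refine ⟨F.biUnion H, ?_, ?_⟩
    · refine (Finset.card_biUnion_le_card_mul _ _ _ fun i _ => hH i).trans ?_
      rw [pow_succ]
      gcongr
    · rintro y ⟨z, h₁, h₂⟩
      exact Finset.mem_biUnion.2 ⟨p z, hF' z h₁, hH' _ z y rfl h₂⟩

/-! ### The game: composition, locality, and refinement of colours -/

/-- Duplicator wins the game of `q` rounds on `G`, with colours `p`, from the position given by a
set of pairs of vertices. -/
def Winning (G : SimpleGraph V) (p : V → ι) : ℕ → Set (V × V) → Prop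
  | 0, S => ∀ x ∈ S, p x.1 = p x.2 ∧
      ∀ y ∈ S, (x.1 = y.1 ↔ x.2 = y.2) ∧ (G.Adj x.1 y.1 ↔ G.Adj x.2 y.2)
  -- The first conjunct follows from the others when `V` is nonempty; including it makes
  -- `Winning.of_le` immediate.
  | q + 1, S => Winning G p q S ∧ (∀ a, ∃ b, Winning G p q (insert (a, b) S)) ∧
      ∀ b, ∃ a, Winning G p q (insert (a, b) S)

lemma Winning.of_le {q q' : ℕ} {S : Set (V × V)} (h : Winning G p q' S) (hq : q ≤ q') :
    Winning G p q S := by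
  induction hq with
  | refl => exact h
  | step _ ih => exact ih h.1

lemma Winning.color {q : ℕ} {S : Set (V × V)} (h : Winning G p q S) {x : V × V} (hx : x ∈ S) :
    p x.1 = p x.2 := (h.of_le (Nat.zero_le q) x hx).1

lemma Winning.mono {q : ℕ} {S T : Set (V × V)} (h : Winning G p q T) (hST : S ⊆ T) :
    Winning G p q S := by
  induction q generalizing S T with
  | zero => exact fun x hx => ⟨(h x (hST hx)).1, fun y hy => (h x (hST hx)).2 y (hST hy)⟩
  | succ q ih =>
    refine ⟨ih h.1 hST, fun a => ?_, fun b => ?_⟩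
    · obtain ⟨b, hb⟩ := h.2.1 a
      exact ⟨b, ih hb (Set.insert_subset_insert hST)⟩
    · obtain ⟨a, ha⟩ := h.2.2 b
      exact ⟨a, ih ha (Set.insert_subset_insert hST)⟩

lemma Winning.coarsen (hp : ∀ x y, p x = p y → p' x = p' y) {q : ℕ} {S : Set (V × V)}
    (h : Winning G p q S) : Winning G p' q S := by
  induction q generalizing S with
  | zero => exact fun x hx => ⟨hp _ _ (h x hx).1, (h x hx).2⟩
  | succ q ih =>
    refine ⟨ih h.1, fun a => ?_, fun b => ?_⟩
    · obtain ⟨b, hb⟩ := h.2.1 a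
      exact ⟨b, ih hb⟩
    · obtain ⟨a, ha⟩ := h.2.2 b
      exact ⟨a, ih ha⟩

lemma winning_diagonal (q : ℕ) {S : Set (V × V)} (h : ∀ x ∈ S, x.1 = x.2) :
    Winning G p q S := by
  induction q generalizing S with
  | zero =>
    intro x hx
    refine ⟨by rw [h x hx], fun y hy => ?_⟩
    rw [h x hx, h y hy]
    simp
  | succ q ih =>
    refine ⟨ih h, fun a => ⟨a, ih ?_⟩, fun a => ⟨a, ih ?_⟩⟩ <;>
    · rintro x (rfl | hx)
      · rfl
      · exact h x hx

lemma insert_swap (a b : V) (S : Set (V × V)) :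
    Prod.swap ⁻¹' (insert (a, b) S) = insert (b, a) (Prod.swap ⁻¹' S) := by
  ext ⟨x, y⟩
  simp [Prod.ext_iff, and_comm]

lemma Winning.swap {q : ℕ} {S : Set (V × V)} (h : Winning G p q S) :
    Winning G p q (Prod.swap ⁻¹' S) := by
  induction q generalizing S with
  | zero =>
    intro x hx
    refine ⟨(h _ hx).1.symm, fun y hy => ?_⟩
    obtain ⟨h₁, h₂⟩ := (h _ hx).2 _ hy
    exact ⟨h₁.symm, h₂.symm⟩
  | succ q ih =>
    refine ⟨ih h.1, fun a => ?_, fun b => ?_⟩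
    · obtain ⟨b, hb⟩ := h.2.2 a
      exact ⟨b, insert_swap b a S ▸ ih hb⟩
    · obtain ⟨a, ha⟩ := h.2.1 b
      exact ⟨a, insert_swap b a S ▸ ih ha⟩

lemma Winning.comp {q : ℕ} {S T U : Set (V × V)} (hS : Winning G p q S) (hT : Winning G p q T)
    (hU : ∀ x ∈ U, ∃ c, (x.1, c) ∈ S ∧ (c, x.2) ∈ T) : Winning G p q U := by
  induction q generalizing S T U with
  | zero =>
    intro x hx
    obtain ⟨c, hc, hc'⟩ := hU x hx
    refine ⟨(hS _ hc).1.trans (hT _ hc').1, fun y hy => ?_⟩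
    obtain ⟨e, he, he'⟩ := hU y hy
    exact ⟨((hS _ hc).2 _ he).1.trans ((hT _ hc').2 _ he').1,
      ((hS _ hc).2 _ he).2.trans ((hT _ hc').2 _ he').2⟩
  | succ q ih =>
    have key : ∀ a c b, ∀ x ∈ insert (a, b) U, ∃ e, (x.1, e) ∈ insert (a, c) S ∧
        (e, x.2) ∈ insert (c, b) T := by
      rintro a c b x (rfl | hx)
      · exact ⟨c, Or.inl rfl, Or.inl rfl⟩
      · obtain ⟨e, he, he'⟩ := hU x hx
        exact ⟨e, Or.inr he, Or.inr he'⟩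
    refine ⟨ih hS.1 hT.1 hU, fun a => ?_, fun b => ?_⟩
    · obtain ⟨c, hc⟩ := hS.2.1 a
      obtain ⟨b, hb⟩ := hT.2.1 c
      exact ⟨b, ih hc hb (key a c b)⟩
    · obtain ⟨c, hc⟩ := hT.2.2 b
      obtain ⟨a, ha⟩ := hS.2.2 c
      exact ⟨a, ih ha hc (key a c b)⟩

/-- Winning positions that are far apart can be combined. -/
lemma Winning.union {q : ℕ} {S T : Set (V × V)} (hS : Winning G p q S) (hT : Winning G p q T)
    (hST : ∀ x ∈ S, ∀ y ∈ T, ¬ Near G p (2 ^ q) x.1 y.1) : Winning G p q (S ∪ T) := by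
  induction q generalizing S T with
  | zero =>
    have cross : ∀ x ∈ S, ∀ y ∈ T, (x.1 = y.1 ↔ x.2 = y.2) ∧
        (G.Adj x.1 y.1 ↔ G.Adj x.2 y.2) := by
      intro x hx y hy
      have hl : ¬ Linked G p x.1 y.1 := fun h => hST x hx y hy ⟨x.1, rfl, h⟩
      have hne : p x.1 ≠ p y.1 := fun h => hl (Or.inl h)
      have hx' := hS.color hx
      have hy' := hT.color hy
      refine ⟨⟨fun h => absurd (congrArg p h) hne,
        fun h => absurd (hx'.trans ((congrArg p h).trans hy'.symm)) hne⟩, ?_⟩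
      constructor
      · intro h
        by_contra h'
        exact hl (Or.inr ⟨x.1, x.2, y.1, y.2, rfl, hx'.symm, rfl, hy'.symm, h, h'⟩)
      · intro h
        by_contra h'
        exact hl (Or.inr ⟨x.2, x.1, y.2, y.1, hx'.symm, rfl, hy'.symm, rfl, h, h'⟩)
    rintro x (hx | hx)
    · refine ⟨hS.color hx, ?_⟩
      rintro y (hy | hy)
      · exact (hS x hx).2 y hy
      · exact cross x hx y hy
    · refine ⟨hT.color hx, ?_⟩
      rintro y (hy | hy)
      · obtain ⟨h₁, h₂⟩ := cross y hy x hx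
        exact ⟨by rw [eq_comm, h₁, eq_comm], by rw [G.adj_comm, h₂, G.adj_comm]⟩
      · exact (hT x hx).2 y hy
  | succ q ih =>
    have hpow : (2 : ℕ) ^ q + 2 ^ q = 2 ^ (q + 1) := by ring
    have far : ∀ x ∈ S, ∀ y ∈ T, ¬ Near G p (2 ^ q) x.1 y.1 := fun x hx y hy h =>
      hST x hx y hy (h.mono (hpow ▸ Nat.le_add_right _ _))
    -- A move within `2 ^ q` of `S` stays farther than `2 ^ q` from `T` and is answered by the
    -- strategy for `S`; every other move is answered by the strategy for `T`.
    have left : ∀ a b, (∃ x ∈ S, Near G p (2 ^ q) x.1 a) → Winning G p q (insert (a, b) S) →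
        Winning G p q (insert (a, b) (S ∪ T)) := by
      rintro a b ⟨x, hx, hxa⟩ h
      rw [← Set.insert_union]
      refine ih h hT.1 ?_
      rintro z (rfl | hz) y hy hn
      · exact hST x hx y hy (hpow ▸ hxa.trans hn)
      · exact far z hz y hy hn
    have right : ∀ a b, (¬ ∃ x ∈ S, Near G p (2 ^ q) x.1 a) → Winning G p q (insert (a, b) T) →
        Winning G p q (insert (a, b) (S ∪ T)) := by
      intro a b hx h
      rw [← Set.union_insert]
      refine ih hS.1 h ?_
      rintro z hz y (rfl | hy) hn
      · exact hx ⟨z, hz, hn⟩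
      · exact far z hz y hy hn
    refine ⟨ih hS.1 hT.1 far, fun a => ?_, fun b => ?_⟩
    · by_cases hx : ∃ x ∈ S, Near G p (2 ^ q) x.1 a
      · obtain ⟨b, hb⟩ := hS.2.1 a
        exact ⟨b, left a b hx hb⟩
      · obtain ⟨b, hb⟩ := hT.2.1 a
        exact ⟨b, right a b hx hb⟩
    · by_cases hx : ∃ x ∈ S, Near G p (2 ^ q) x.1 b
      · obtain ⟨a, ha⟩ := hS.2.2 b
        have hab : p a = p b := ha.color (Set.mem_insert _ _)
        obtain ⟨x, hxS, hxb⟩ := hx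
        exact ⟨a, left a b ⟨x, hxS, hxb.congr_right hab.symm⟩ ha⟩
      · obtain ⟨a, ha⟩ := hT.2.2 b
        have hab : p a = p b := ha.color (Set.mem_insert _ _)
        exact ⟨a, right a b (fun ⟨x, hxS, hxa⟩ => hx ⟨x, hxS, hxa.congr_right hab⟩) ha⟩

/-- Away from the only class `c` in which `p'` is coarser than `p`, a position that is winning for
`p'` is winning for `p`. -/
lemma Winning.refine_of_far {c : V} (hp : ∀ x y, p x = p y → p' x = p' y)
    (hp' : ∀ x y, p' x = p' y → p x = p y ∨ p' x = p' c) {q : ℕ} {S : Set (V × V)}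
    (h : Winning G p' q S) (hS : ∀ x ∈ S, ¬ Near G p' (2 ^ q) c x.1) : Winning G p q S := by
  induction q generalizing S with
  | zero =>
    intro x hx
    refine ⟨?_, (h x hx).2⟩
    rcases hp' _ _ (h x hx).1 with h' | h'
    · exact h'
    · exact absurd (near_self _ h'.symm) (hS x hx)
  | succ q ih =>
    have hpow : (2 : ℕ) ^ q + 2 ^ q = 2 ^ (q + 1) := by ring
    have far : ∀ x ∈ S, ¬ Near G p' (2 ^ q) c x.1 := fun x hx hn =>
      hS x hx (hn.mono (hpow ▸ Nat.le_add_right _ _))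
    have h₀ := ih h.1 far
    have near : ∀ a b, (∃ x ∈ S, Near G p' (2 ^ q) x.1 a) → Winning G p' q (insert (a, b) S) →
        Winning G p q (insert (a, b) S) := by
      rintro a b ⟨x, hx, hxa⟩ h'
      refine ih h' ?_
      rintro z (rfl | hz) hn
      · exact hS x hx (hpow ▸ hn.trans hxa.symm)
      · exact far z hz hn
    -- A move far from `S` is answered by itself: the diagonal position wins for every colouring,
    -- and `Winning.union` joins it to `S`.
    have away : ∀ a, (¬ ∃ x ∈ S, Near G p' (2 ^ q) x.1 a) →
        Winning G p q (insert (a, a) S) := by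
      intro a ha
      rw [← Set.union_singleton]
      refine h₀.union (winning_diagonal q (by simp)) ?_
      rintro x hx y rfl hn
      exact ha ⟨x, hx, hn.coarsen hp⟩
    refine ⟨h₀, fun a => ?_, fun b => ?_⟩
    · by_cases ha : ∃ x ∈ S, Near G p' (2 ^ q) x.1 a
      · obtain ⟨b, hb⟩ := h.2.1 a
        exact ⟨b, near a b ha hb⟩
      · exact ⟨a, away a ha⟩
    · by_cases hb : ∃ x ∈ S, Near G p' (2 ^ q) x.1 b
      · obtain ⟨a, ha⟩ := h.2.2 b
        have hab : p' a = p' b := ha.color (Set.mem_insert _ _)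
        obtain ⟨x, hxS, hxb⟩ := hb
        exact ⟨a, near a b ⟨x, hxS, hxb.congr_right hab.symm⟩ ha⟩
      · exact ⟨b, away b hb⟩

/-! ### Positions given by pairs of tuples, and their decomposition along empty annuli -/

/-- The position matching the entries of two tuples whose indices lie in `D`. -/
def pairs (x y : κ → V) (D : Set κ) : Set (V × V) := (fun i => (x i, y i)) '' D

lemma pairs_mono (x y : κ → V) {D E : Set κ} (h : D ⊆ E) : pairs x y D ⊆ pairs x y E :=
  Set.image_mono h

lemma Winning.pairs_symm {q : ℕ} {x y : κ → V} {D : Set κ} (h : Winning G p q (pairs x y D)) :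
    Winning G p q (pairs y x D) := by
  refine h.swap.mono ?_
  rintro _ ⟨i, hi, rfl⟩
  exact ⟨i, hi, rfl⟩

lemma Winning.pairs_trans {q : ℕ} {x y z : κ → V} {D : Set κ}
    (h : Winning G p q (pairs x y D)) (h' : Winning G p q (pairs y z D)) :
    Winning G p q (pairs x z D) := by
  refine h.comp h' ?_
  rintro _ ⟨i, hi, rfl⟩
  exact ⟨y i, ⟨i, hi, rfl⟩, ⟨i, hi, rfl⟩⟩

lemma winning_pairs_refl (q : ℕ) (x : κ → V) (D : Set κ) : Winning G p q (pairs x x D) := by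
  refine winning_diagonal q ?_
  rintro _ ⟨i, hi, rfl⟩
  rfl

lemma Winning.pairs_color {q : ℕ} {x y : κ → V} {D : Set κ} (h : Winning G p q (pairs x y D))
    {i : κ} (hi : i ∈ D) : p (x i) = p (y i) := h.color (x := (x i, y i)) ⟨i, hi, rfl⟩

lemma Winning.pairs_union {q : ℕ} {x y : κ → V} {D E : Set κ}
    (hD : Winning G p q (pairs x y D)) (hE : Winning G p q (pairs x y E))
    (h : ∀ i ∈ D, ∀ j ∈ E, ¬ Near G p (2 ^ q) (x i) (x j)) :
    Winning G p q (pairs x y (D ∪ E)) := by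
  rw [pairs, Set.image_union]
  refine hD.union hE ?_
  rintro _ ⟨i, hi, rfl⟩ _ ⟨j, hj, rfl⟩
  exact h i hi j hj

/-- Among boundedly many vertices, some annulus around `c` contains none. -/
lemma exists_gap [Fintype κ] (G : SimpleGraph V) (p : V → ι) (r : ℕ) (c : V) (x : κ → V) :
    ∃ l ≤ Fintype.card κ, ∀ i, Near G p ((l + 1) * r) c (x i) → Near G p (l * r) c (x i) := by
  classical
  by_contra! hcon
  have key : ∀ l ≤ Fintype.card κ + 1,
      l ≤ (Finset.univ.filter fun i => Near G p (l * r) c (x i)).card := by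
    intro l
    induction l with
    | zero => simp
    | succ l ih =>
      intro hl
      refine Nat.succ_le_of_lt ((ih (by omega)).trans_lt (Finset.card_lt_card ?_))
      obtain ⟨i, hi, hi'⟩ := hcon l (by omega)
      refine Finset.ssubset_iff_subset_ne.2 ⟨?_, fun h => ?_⟩
      · intro j hj
        simp only [Finset.mem_filter, Finset.mem_univ, true_and] at hj ⊢
        exact hj.mono (Nat.mul_le_mul_right _ (by omega))
      · have : i ∈ Finset.univ.filter fun i => Near G p ((l + 1) * r) c (x i) := by simpa using hi
        rw [← h] at this
        exact hi' (by simpa using this)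
  have := (key _ le_rfl).trans (Finset.card_le_univ _)
  omega

/-- If the two sides of an empty annulus are winning, so is the whole position. -/
lemma Winning.pairs_of_gap {q l : ℕ} {c : V} {x y : κ → V} {D : Set κ}
    (hl : ∀ i ∈ D, Near G p ((l + 1) * 2 ^ q) c (x i) → Near G p (l * 2 ^ q) c (x i))
    (hin : Winning G p q (pairs x y {i ∈ D | Near G p (l * 2 ^ q) c (x i)}))
    (hout : Winning G p q (pairs x y {i ∈ D | ¬ Near G p (l * 2 ^ q) c (x i)})) :
    Winning G p q (pairs x y D) := by
  refine (hin.pairs_union hout ?_).mono (pairs_mono _ _ ?_)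
  · rintro i ⟨hi, hi'⟩ j ⟨hj, hj'⟩ hn
    exact hj' (hl j hj (by simpa [add_mul] using hi'.trans hn))
  · intro i hi
    by_cases h : Near G p (l * 2 ^ q) c (x i)
    · exact Or.inl ⟨hi, h⟩
    · exact Or.inr ⟨hi, h⟩

/-- A losing position contains a losing position within a ball. -/
lemma exists_local_of_not_winning [Fintype κ] {q : ℕ} {x y : κ → V} {D : Set κ}
    (h : ¬ Winning G p q (pairs x y D)) :
    ∃ E ⊆ D, ∃ i ∈ E, ¬ Winning G p q (pairs x y E) ∧
      ∀ j ∈ E, Near G p (Fintype.card κ * 2 ^ q) (x i) (x j) := by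
  induction hn : D.ncard using Nat.strong_induction_on generalizing D with
  | _ n ih =>
    obtain ⟨i, hi⟩ : D.Nonempty := by
      rw [Set.nonempty_iff_ne_empty]
      rintro rfl
      exact h (winning_diagonal q (by simp [pairs]))
    obtain ⟨l, hl, hl'⟩ := exists_gap G p (2 ^ q) (x i) x
    -- Split at the empty annulus around `x i`. If the inner part wins, the outer part loses, and it
    -- has fewer indices because it misses `i`.
    by_cases hin : Winning G p q (pairs x y {j ∈ D | Near G p (l * 2 ^ q) (x i) (x j)})
    · have hout : ¬ Winning G p q (pairs x y {j ∈ D | ¬ Near G p (l * 2 ^ q) (x i) (x j)}) :=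
        fun hout => h (Winning.pairs_of_gap (fun j _ => hl' j) hin hout)
      obtain ⟨E, hE, hE'⟩ := ih _ (by
        rw [← hn]
        refine Set.ncard_lt_ncard ⟨Set.sep_subset _ _, fun hs => ?_⟩ (Set.toFinite _)
        exact (hs hi).2 (near_self _ rfl)) hout rfl
      exact ⟨E, hE.trans (Set.sep_subset _ _), hE'⟩
    · exact ⟨{j ∈ D | Near G p (l * 2 ^ q) (x i) (x j)}, Set.sep_subset _ _, i,
        ⟨hi, near_self _ rfl⟩, hin, fun j hj => hj.2.mono (Nat.mul_le_mul_right _ hl)⟩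

end Game

/-! ### Boundedly many game classes -/

/-- Names for the elements of `F` out of a set of bounded size; the extra value keeps the target
nonempty when `F` is empty. -/
lemma exists_injOn_fin {ι : Type v} {n : ℕ} (F : Finset ι) (hF : F.card ≤ n) :
    ∃ f : ι → Fin (n + 1), Set.InjOn f F := by
  classical
  refine ⟨fun i => if h : i ∈ F then Fin.castLE (by omega) (F.equivFin ⟨i, h⟩) else 0, ?_⟩
  intro i hi j hj hij
  simp only [Finset.mem_coe] at hi hj
  simp only [hi, hj, dite_true] at hij
  have := F.equivFin.injective (Fin.castLE_injective _ hij)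
  simpa using this

/-- For no rounds the code is the atomic type. For `q + 1` rounds, moves far from the tuple are
answered by themselves, so only the classes of extensions by a nearby vertex need to be recorded,
together with the colour of that vertex; nearby colours are boundedly many. -/
lemma exists_code_fin (d q : ℕ) : ∀ n : ℕ, ∃ K : ℕ, ∀ (V : Type u) (ι : Type v)
    (G : SimpleGraph V) (p : V → ι), BoundedLinks G p d →
    ∃ f : (Fin n → V) → Fin K, ∀ x y, (∀ i, p (x i) = p (y i)) → f x = f y →
      Winning G p q (pairs x y Set.univ) := by
  classical
  induction q with
  | zero =>
    intro n
    refine ⟨Fintype.card (Fin n → Fin n → Prop × Prop), fun V ι G p _ =>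
      ⟨fun x => Fintype.equivFin _ fun i j => (x i = x j, G.Adj (x i) (x j)), ?_⟩⟩
    intro x y hp hf
    have hf := (Fintype.equivFin _).injective hf
    rintro _ ⟨i, -, rfl⟩
    refine ⟨hp i, ?_⟩
    rintro _ ⟨j, -, rfl⟩
    have := congrFun (congrFun hf i) j
    simp only [Prod.mk.injEq, eq_iff_iff] at this
    exact this
  | succ q ih =>
    intro n
    obtain ⟨K₀, hK₀⟩ := ih n
    obtain ⟨K₁, hK₁⟩ := ih (n + 1)
    let L := n * (d + 1) ^ 2 ^ q
    refine ⟨Fintype.card (Fin K₀ × Set (Fin (L + 1) × Fin K₁)), fun V ι G p hd => ?_⟩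
    obtain ⟨f₀, hf₀⟩ := hK₀ V ι G p hd
    obtain ⟨f₁, hf₁⟩ := hK₁ V ι G p hd
    -- The naming `g` depends only on the colours of the tuple, so `x` and `y` of equal colours use
    -- the same names.
    have hcode : ∀ c : Fin n → ι, ∃ g : ι → Fin (L + 1), ∀ x : Fin n → V, (∀ i, p (x i) = c i) →
        ∀ a b, (∃ i, Near G p (2 ^ q) (x i) a) → (∃ i, Near G p (2 ^ q) (x i) b) →
          g (p a) = g (p b) → p a = p b := by
      intro c
      by_cases hc : ∃ x : Fin n → V, ∀ i, p (x i) = c i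
      · obtain ⟨x, hx⟩ := hc
        choose F hF hF' using fun i => hd.ball (2 ^ q) (x i)
        obtain ⟨g, hg⟩ := exists_injOn_fin (n := L) (Finset.univ.biUnion F) (by
          refine (Finset.card_biUnion_le_card_mul _ _ _ fun i _ => hF i).trans ?_
          simp [L])
        refine ⟨g, fun y hy a b ha hb hab => hg ?_ ?_ hab⟩
        · obtain ⟨i, hi⟩ := ha
          exact Finset.mem_coe.2 (Finset.mem_biUnion.2 ⟨i, Finset.mem_univ _,
            hF' i a (hi.congr_left ((hy i).trans (hx i).symm))⟩)
        · obtain ⟨i, hi⟩ := hb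
          exact Finset.mem_coe.2 (Finset.mem_biUnion.2 ⟨i, Finset.mem_univ _,
            hF' i b (hi.congr_left ((hy i).trans (hx i).symm))⟩)
      · exact ⟨fun _ => 0, fun x hx => absurd ⟨x, hx⟩ hc⟩
    choose g hg using hcode
    let near : (Fin n → V) → Set (Fin (L + 1) × Fin K₁) := fun x =>
      {z | ∃ a, (∃ i, Near G p (2 ^ q) (x i) a) ∧
        z = (g (fun i => p (x i)) (p a), f₁ (Fin.snoc x a))}
    have forth : ∀ x y, (∀ i, p (x i) = p (y i)) → f₀ x = f₀ y → near x = near y →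
        ∀ a, ∃ b, Winning G p q (insert (a, b) (pairs x y Set.univ)) := by
      intro x y hp h₀ h₁ a
      by_cases ha : ∃ i, Near G p (2 ^ q) (x i) a
      · have hz : (g (fun i => p (x i)) (p a), f₁ (Fin.snoc x a)) ∈ near y := by
          rw [← h₁]
          exact ⟨a, ha, rfl⟩
        obtain ⟨b, hb, hab⟩ := hz
        simp only [Prod.mk.injEq] at hab
        have hcol : (fun i => p (y i)) = fun i => p (x i) := funext fun i => (hp i).symm
        rw [hcol] at hab
        obtain ⟨i, hi⟩ := hb
        have hpab := hg _ x (fun _ => rfl) a b ha ⟨i, hi.congr_left (hp i).symm⟩ hab.1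
        refine ⟨b, (hf₁ _ _ ?_ hab.2).mono ?_⟩
        · intro j
          refine Fin.lastCases ?_ (fun j => ?_) j
          · simpa using hpab
          · simpa using hp j
        · rintro _ (rfl | ⟨j, -, rfl⟩)
          · exact ⟨Fin.last n, trivial, by simp⟩
          · exact ⟨j.castSucc, trivial, by simp⟩
      · refine ⟨a, ?_⟩
        rw [← Set.union_singleton]
        refine (hf₀ x y hp h₀).union (winning_diagonal q (by simp)) ?_
        rintro _ ⟨i, -, rfl⟩ _ rfl hn
        exact ha ⟨i, hn⟩
    refine ⟨fun x => Fintype.equivFin _ (f₀ x, near x), fun x y hp hf => ?_⟩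
    have hf := (Fintype.equivFin _).injective hf
    simp only [Prod.mk.injEq] at hf
    refine ⟨hf₀ x y hp hf.1, forth x y hp hf.1 hf.2, fun b => ?_⟩
    obtain ⟨a, ha⟩ := forth y x (fun i => (hp i).symm) hf.1.symm hf.2.symm b
    refine ⟨a, ha.swap.mono ?_⟩
    rintro _ (rfl | ⟨j, -, rfl⟩)
    · exact Or.inl rfl
    · exact Or.inr ⟨j, trivial, rfl⟩

/-- For colourings with boundedly many links, partial tuples with the same colours fall into
boundedly many classes of the game. -/
lemma exists_code (κ : Type w) [Fintype κ] (d q : ℕ) : ∃ K : ℕ, ∀ (V : Type u) (ι : Type v)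
    (G : SimpleGraph V) (p : V → ι), BoundedLinks G p d →
    ∃ f : Set κ → (κ → V) → Fin K, ∀ D x y, (∀ i ∈ D, p (x i) = p (y i)) → f D x = f D y →
      Winning G p q (pairs x y D) := by
  classical
  choose K hK using exists_code_fin.{u, v} d q
  refine ⟨∑ n ∈ Finset.range (Fintype.card κ + 1), K n, fun V ι G p hd => ?_⟩
  have hle : ∀ D : Set κ, K (Fintype.card D) ≤
      ∑ n ∈ Finset.range (Fintype.card κ + 1), K n := fun D =>
    Finset.single_le_sum (f := K) (fun _ _ => Nat.zero_le _)
      (Finset.mem_range.2 (Nat.lt_succ_of_le (Fintype.card_subtype_le _)))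
  choose f hf using fun n => hK n V ι G p hd
  refine ⟨fun D x => Fin.castLE (hle D)
    (f _ fun i => x ((Fintype.equivFin D).symm i)), fun D x y hp h => ?_⟩
  refine (hf _ _ _ (fun i => hp _ (Subtype.coe_prop _)) (Fin.castLE_injective _ h)).mono ?_
  rintro _ ⟨i, hi, rfl⟩
  exact ⟨Fintype.equivFin D ⟨i, hi⟩, trivial, by simp⟩

/-! ### Contraction sequences as sequences of colourings -/

/-- A sequence of colourings that become coarser by merging at most two colour classes at a time,
from an injective colouring to a constant one, with boundedly many links throughout. -/
structure IsContraction {V : Type u} {ι : Type v} (G : SimpleGraph V) (d : ℕ)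
    (p : ℕ → V → ι) : Prop where
  injective : Function.Injective (p 0)
  coarsen : ∀ t x y, p t x = p t y → p (t + 1) x = p (t + 1) y
  merge : ∀ t, ∃ a b, ∀ x y, p (t + 1) x = p (t + 1) y → p t x = p t y ∨
    (p (t + 1) x = p (t + 1) a ∧ (p t x = p t a ∨ p t x = p t b))
  links : ∀ t, BoundedLinks G (p t) d
  eventually_const : ∃ N, ∀ t ≥ N, ∀ x y, p t x = p t y

section Contraction

variable {V : Type u} {ι : Type v} {κ : Type w} {G : SimpleGraph V} {d : ℕ} {p : ℕ → V → ι}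

lemma IsContraction.coarsen_le (h : IsContraction G d p) {s t : ℕ} (hst : s ≤ t) (x y : V)
    (hxy : p s x = p s y) : p t x = p t y := by
  induction hst with
  | refl => exact hxy
  | step _ ih => exact h.coarsen _ _ _ ih

/-- Around the class merged at time `t + 1` there are boundedly many classes of time `t`. -/
lemma IsContraction.exists_center (h : IsContraction G d p) (t : ℕ) :
    ∃ c : V, (∀ x y, p (t + 1) x = p (t + 1) y → p t x = p t y ∨ p (t + 1) x = p (t + 1) c) ∧
      ∀ r, ∃ F : Finset ι, F.card ≤ (d + 1) ^ r + 2 ∧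
        ∀ x, Near G (p (t + 1)) r c x → p t x ∈ F := by
  classical
  obtain ⟨a, b, hab⟩ := h.merge t
  refine ⟨a, fun x y hxy => (hab x y hxy).imp_right And.left, fun r => ?_⟩
  obtain ⟨F, hF, hF'⟩ := (h.links (t + 1)).ball r a
  -- A class of time `t + 1` other than the merged one is a single class of time `t`, which `g`
  -- returns; the merged class contributes those of `a` and `b`.
  let g : ι → ι := fun i => if hi : ∃ x, p (t + 1) x = i then p t hi.choose else i
  refine ⟨insert (p t a) (insert (p t b) (F.image g)), ?_, fun x hx => ?_⟩
  · have h₁ := Finset.card_insert_le (p t a) (insert (p t b) (F.image g))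
    have h₂ := Finset.card_insert_le (p t b) (F.image g)
    have h₃ := Finset.card_image_le (s := F) (f := g)
    omega
  · have hi : ∃ y, p (t + 1) y = p (t + 1) x := ⟨x, rfl⟩
    rcases hab x _ hi.choose_spec.symm with h' | ⟨-, h' | h'⟩
    · refine Finset.mem_insert_of_mem (Finset.mem_insert_of_mem ?_)
      refine Finset.mem_image.2 ⟨p (t + 1) x, hF' x hx, ?_⟩
      simp only [g, hi, dite_true]
      exact h'.symm
    · simp [h']
    · simp [h']

end Contraction

/-! ### Times at which game classes change -/

/-- Each strict drop uses up at least one unit of `f 0`. -/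
lemma exists_cover_of_antitone (f : ℕ → ℕ) (hf : Antitone f) :
    ∃ T : Finset ℕ, T.card ≤ f 0 ∧ ∀ t, f (t + 1) < f t → t ∈ T := by
  classical
  have key : ∀ n, ((Finset.range n).filter fun t => f (t + 1) < f t).card + f n ≤ f 0 := by
    intro n
    induction n with
    | zero => simp
    | succ n ih =>
      rw [Finset.range_add_one, Finset.filter_insert]
      have := hf (Nat.le_succ n)
      split_ifs with h
      · rw [Finset.card_insert_of_notMem (by simp)]
        omega
      · simp only [Nat.succ_eq_add_one] at this
        omega
  have hconst : ∃ n, ∀ t ≥ n, f t = f n := by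
    obtain ⟨m, ⟨n, hn⟩, hm⟩ := WellFounded.has_min (wellFounded_lt (α := ℕ)) (Set.range f)
      ⟨f 0, 0, rfl⟩
    refine ⟨n, fun t ht => le_antisymm (hf ht) ?_⟩
    rw [hn]
    exact not_lt.1 (hm _ ⟨t, rfl⟩)
  obtain ⟨n, hn⟩ := hconst
  refine ⟨(Finset.range n).filter fun t => f (t + 1) < f t, by have := key n; omega, ?_⟩
  intro t ht
  simp only [Finset.mem_filter, Finset.mem_range]
  refine ⟨?_, ht⟩
  by_contra h
  have h₁ := hn t (by omega)
  have h₂ := hn (t + 1) (by omega)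
  omega

/-- A chain of equivalence relations, coarser and coarser from time `s` on, starting with at most
`K` classes, changes at most `K` times. -/
lemma exists_cover_of_setoid {Y : Type u} [Finite Y] (r : ℕ → Setoid Y)
    (hr : ∀ t, r t ≤ r (t + 1)) (s K : ℕ) (f : Y → Fin K) (hf : ∀ y z, f y = f z → r s y z) :
    ∃ T : Finset ℕ, T.card ≤ K ∧ ∀ t ≥ s, r (t + 1) ≠ r t → t ∈ T := by
  classical
  have hmono : Monotone r := monotone_nat_of_le_succ hr
  let φ : ∀ t, Quotient (r t) → Quotient (r (t + 1)) := fun t =>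
    Quotient.map id fun _ _ h => hr t h
  have hφ : ∀ t, Function.Surjective (φ t) := by
    intro t y
    induction y using Quotient.inductionOn with
    | _ y => exact ⟨Quotient.mk _ y, rfl⟩
  have hle : ∀ t, Nat.card (Quotient (r (t + 1))) ≤ Nat.card (Quotient (r t)) := fun t =>
    Nat.card_le_card_of_surjective _ (hφ t)
  obtain ⟨T, hT, hT'⟩ := exists_cover_of_antitone (fun t => Nat.card (Quotient (r (s + t))))
    (antitone_nat_of_succ_le fun t => hle (s + t))
  refine ⟨T.image (s + ·), Finset.card_image_le.trans (hT.trans ?_), fun t ht hne => ?_⟩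
  · have : Function.Injective fun y : Quotient (r (s + 0)) => f y.out := by
      intro y z hyz
      rw [← Quotient.out_eq y, ← Quotient.out_eq z]
      exact Quotient.sound (hf _ _ hyz)
    simpa using Nat.card_le_card_of_injective _ this
  · obtain ⟨t, rfl⟩ := Nat.exists_eq_add_of_le ht
    refine Finset.mem_image.2 ⟨t, hT' t (lt_of_le_of_ne (hle (s + t)) fun heq => hne ?_), rfl⟩
    refine le_antisymm (fun {y z} hyz => ?_) (hr _)
    have hinj : Function.Injective (φ (s + t)) :=
      ((Nat.bijective_iff_surjective_and_card _).2 ⟨hφ _, heq.symm⟩).1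
    exact Quotient.exact (hinj (a₁ := Quotient.mk _ y) (a₂ := Quotient.mk _ z)
      (Quotient.sound hyz))

section Events

variable {V : Type u} {ι : Type v} {κ : Type w} {G : SimpleGraph V} {d : ℕ} {p : ℕ → V → ι}

/-- At time `t + 1` two partial tuples of elements of `B` become equivalent in the game. -/
def IsEvent (κ : Type w) (G : SimpleGraph V) (p : ℕ → V → ι) (q : ℕ) (B : Set V) (t : ℕ) : Prop :=
  ∃ (x y : κ → V) (D : Set κ), (∀ i ∈ D, x i ∈ B ∧ y i ∈ B) ∧
    Winning G (p (t + 1)) q (pairs x y D) ∧ ¬ Winning G (p t) q (pairs x y D)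

/-- The elements of `B` sharing a colour with an entry `x i`, `i ∈ E`, are the same at the times `t`
and `t + 1`. -/
def IsStable (p : ℕ → V → ι) (B : Set V) (x : κ → V) (E : Set κ) (t : ℕ) : Prop :=
  ∀ i ∈ E, ∀ y ∈ B, p (t + 1) y = p (t + 1) (x i) → p t y = p t (x i)

/-- The events that happen to tuples with colours `c` at time `e`, at times from which on these
tuples are stable until `e`, are boundedly many. -/
lemma exists_cover_of_stable [Finite V] [Finite κ] (h : IsContraction G d p) {q K : ℕ} (B : Set V)
    (E : Set κ) (hK : ∀ t, ∃ f : (κ → V) → Fin K, ∀ x y, (∀ i ∈ E, p t (x i) = p t (y i)) →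
      f x = f y → Winning G (p t) q (pairs x y E)) (e : ℕ) (c : κ → ι) :
    ∃ T : Finset ℕ, T.card ≤ K ∧ ∀ t ≤ e, ∀ x y : κ → V,
      (∀ i ∈ E, x i ∈ B ∧ y i ∈ B) → (∀ i ∈ E, p t (x i) = p t (y i)) →
      (∀ i ∈ E, p e (x i) = c i) → (∀ s, t ≤ s → s < e → IsStable p B x E s) →
      Winning G (p (t + 1)) q (pairs x y E) → ¬ Winning G (p t) q (pairs x y E) → t ∈ T := by
  classical
  let Y := {x : E → V // ∀ i, x i ∈ B ∧ p e (x i) = c i}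
  let r : ℕ → Setoid Y := fun t =>
    { r := fun x y => Winning G (p t) q (pairs x.1 y.1 Set.univ)
      iseqv := ⟨fun x => winning_pairs_refl _ _ _, fun h => h.pairs_symm,
        fun h h' => h.pairs_trans h'⟩ }
  have hr : ∀ t, r t ≤ r (t + 1) := fun t x y hxy => Winning.coarsen (h.coarsen t) hxy
  let good : ℕ → Prop := fun t => t ≤ e ∧ ∃ x : κ → V, (∀ i ∈ E, x i ∈ B) ∧
    (∀ i ∈ E, p e (x i) = c i) ∧ ∀ s, t ≤ s → s < e → IsStable p B x E s
  by_cases hgood : ∃ t, good t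
  · let s := Nat.find hgood
    obtain ⟨hse, x₀, hx₀B, hx₀c, hx₀⟩ : good s := Nat.find_spec hgood
    -- Stability of `x₀` lets equality of colours be pulled back from time `e` to `s`. So at time
    -- `s`, the earliest good one, all tuples of `Y` have the same colours and form at most `K`
    -- classes.
    have hback : ∀ z : κ → V, (∀ i ∈ E, z i ∈ B ∧ p e (z i) = c i) →
        ∀ i ∈ E, p s (z i) = p s (x₀ i) := by
      intro z hz i hi
      refine Nat.decreasingInduction' (P := fun t => p t (z i) = p t (x₀ i))
        (fun t ht hst ih => hx₀ t hst ht i hi _ (hz i hi).1 ih) hse ?_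
      rw [(hz i hi).2, hx₀c i hi]
    obtain ⟨f, hf⟩ := hK s
    let ext : Y → κ → V := fun y i => if hi : i ∈ E then y.1 ⟨i, hi⟩ else x₀ i
    have hext : ∀ (y : Y) (i : E), ext y i = y.1 i := fun y i => by simp [ext]
    have hextY : ∀ y : Y, ∀ i ∈ E, ext y i ∈ B ∧ p e (ext y i) = c i := by
      intro y i hi
      rw [hext y ⟨i, hi⟩]
      exact y.2 ⟨i, hi⟩
    obtain ⟨T, hT, hT'⟩ := exists_cover_of_setoid r hr s K (fun y => f (ext y)) (by
      intro y z hyz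
      refine (hf _ _ (fun i hi => ?_) hyz).mono ?_
      · rw [hback _ (hextY y) i hi, hback _ (hextY z) i hi]
      · rintro _ ⟨i, -, rfl⟩
        exact ⟨i, i.2, by simp [hext]⟩)
    refine ⟨T, hT, fun t hte x y hB hcol hc hst hw hn => hT' t ?_ fun heq => hn ?_⟩
    · exact Nat.find_min' hgood ⟨hte, x, fun i hi => (hB i hi).1, hc, hst⟩
    · have hyc : ∀ i ∈ E, p e (y i) = c i := by
        intro i hi
        rw [← hc i hi]
        exact (h.coarsen_le hte _ _ (hcol i hi)).symm
      let x' : Y := ⟨fun i => x i, fun i => ⟨(hB i i.2).1, hc i i.2⟩⟩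
      let y' : Y := ⟨fun i => y i, fun i => ⟨(hB i i.2).2, hyc i i.2⟩⟩
      have hxy : r (t + 1) x' y' := by
        refine hw.mono ?_
        rintro _ ⟨i, -, rfl⟩
        exact ⟨i, i.2, rfl⟩
      rw [heq] at hxy
      refine Winning.mono hxy ?_
      rintro _ ⟨i, hi, rfl⟩
      exact ⟨⟨i, hi⟩, trivial, rfl⟩
  · refine ⟨∅, by simp, fun t hte x y hB hcol hc hst _ _ => absurd ⟨t, ?_⟩ hgood⟩
    exact ⟨hte, x, fun i hi => (hB i hi).1, hc, hst⟩

/-- The number of times at which tuples of elements of `B` become equivalent in the game is at most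
linear in the number of elements of `B`. -/
theorem exists_cover_events (κ : Type w) [Fintype κ] (d q : ℕ) : ∃ K : ℕ,
    ∀ (V : Type u) [Finite V] (ι : Type v) (G : SimpleGraph V) (p : ℕ → V → ι),
      IsContraction G d p → ∀ B : Finset V, B.Nonempty →
        ∃ T : Finset ℕ, T.card ≤ K * B.card ∧ ∀ t, IsEvent κ G p q B t → t ∈ T := by
  classical
  obtain ⟨K, hK⟩ := exists_code.{u, v} κ d q
  let ρ := Fintype.card κ * 2 ^ q
  let L := (d + 1) ^ (ρ + ρ) + 2
  -- The `1` pays for the merge times `T₁`, and the `2` for `insert N T₁`, which has at most `2 *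
  -- B.card` elements. For each of these, a set `E`, a colour tuple and a class change are chosen.
  refine ⟨1 + 2 * (Fintype.card (Set κ) * (L ^ Fintype.card κ * K)),
    fun V _ ι G p h B hB => ?_⟩
  obtain ⟨N, hN⟩ := h.eventually_const
  choose c hc hF using h.exists_center
  choose F hFcard hFmem using fun t => hF t (ρ + ρ)
  have hg : ∀ t, ∃ g : ι → ι, ∀ x ∈ B, g (p t x) = p (t + 1) x := by
    intro t
    refine ⟨fun i => if hi : ∃ x ∈ B, p t x = i then p (t + 1) hi.choose else i, fun x hx => ?_⟩
    have hi : ∃ y ∈ B, p t y = p t x := ⟨x, hx, rfl⟩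
    simp only [hi, dite_true]
    exact h.coarsen _ _ _ hi.choose_spec.2
  choose g hg using hg
  have himage : ∀ t, (B.image (p t)).image (g t) = B.image (p (t + 1)) := fun t => by
    rw [Finset.image_image]
    exact Finset.image_congr fun x hx => hg t x hx
  obtain ⟨T₁, hT₁, hT₁'⟩ := exists_cover_of_antitone (fun t => (B.image (p t)).card)
    (antitone_nat_of_succ_le fun t => by
      rw [← himage]
      exact Finset.card_image_le)
  have hT₁B : T₁.card ≤ B.card := hT₁.trans Finset.card_image_le
  have hmerge : ∀ t, ∀ x ∈ B, ∀ y ∈ B, p (t + 1) x = p (t + 1) y → p t x ≠ p t y → t ∈ T₁ := by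
    intro t x hx y hy hxy hne
    refine hT₁' t ?_
    by_contra hlt
    have hinj : Set.InjOn (g t) (B.image (p t)) := by
      refine Finset.injOn_of_card_image_eq (le_antisymm Finset.card_image_le ?_)
      rw [himage]
      exact not_lt.1 hlt
    exact hne (hinj (Finset.mem_coe.2 (Finset.mem_image_of_mem _ hx))
      (Finset.mem_coe.2 (Finset.mem_image_of_mem _ hy)) (by rw [hg t x hx, hg t y hy, hxy]))
  have hstable := fun (E : Set κ) => exists_cover_of_stable h (q := q) (K := K) (B : Set V) E
    fun t => by
      obtain ⟨f, hf⟩ := hK V ι G (p t) (h.links t)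
      exact ⟨f E, hf E⟩
  choose T hT hT' using hstable
  refine ⟨T₁ ∪ (insert N T₁).biUnion fun e => Finset.univ.biUnion fun E =>
    (Fintype.piFinset fun _ : κ => F e).biUnion fun i => T E e i, ?_, ?_⟩
  · have h₁ : ∀ e, (Finset.univ.biUnion fun E : Set κ => (Fintype.piFinset fun _ : κ =>
        F e).biUnion fun i => T E e i).card ≤ Fintype.card (Set κ) * (L ^ Fintype.card κ * K) := by
      intro e
      refine Finset.card_biUnion_le_card_mul _ _ _ fun E _ => ?_
      refine (Finset.card_biUnion_le_card_mul _ _ _ fun i _ => hT E e i).trans ?_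
      rw [Fintype.card_piFinset, Finset.prod_const, Finset.card_univ]
      gcongr
      exact hFcard e
    have h₂ := Finset.card_biUnion_le_card_mul (insert N T₁) _ _ fun e _ => h₁ e
    have h₃ := Finset.card_insert_le N T₁
    have h₄ := hB.card_pos
    refine (Finset.card_union_le _ _).trans ((Nat.add_le_add hT₁B h₂).trans ?_)
    have h₅ : (insert N T₁).card ≤ 2 * B.card := by omega
    calc B.card + (insert N T₁).card * (Fintype.card (Set κ) * (L ^ Fintype.card κ * K))
        ≤ B.card + 2 * B.card * (Fintype.card (Set κ) * (L ^ Fintype.card κ * K)) := by gcongr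
      _ = _ := by ring
  · rintro t ⟨x, y, D, hxy, hw, hn⟩
    by_cases ht : t ∈ T₁
    · exact Finset.mem_union_left _ ht
    refine Finset.mem_union_right _ ?_
    have htN : t ≤ N := by
      by_contra hlt
      exact hn (hw.coarsen fun x y _ => hN t (by omega) x y)
    have hcol : ∀ i ∈ D, p t (x i) = p t (y i) := by
      intro i hi
      by_contra hne
      exact ht (hmerge t _ (hxy i hi).1 _ (hxy i hi).2 (hw.pairs_color hi) hne)
    obtain ⟨E, hED, i₀, hi₀, hnE, hnear⟩ := exists_local_of_not_winning hn
    have hwE := hw.mono (pairs_mono _ _ hED)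
    -- the time `e` until which the tuple is stable
    have hdeath : ∃ e, e ∈ insert N T₁ ∧ t ≤ e ∧ (∀ s, t ≤ s → s < e → IsStable p B x E s) ∧
        ∃ i ∈ E, p (e + 1) (c e) = p (e + 1) (x i) := by
      by_cases hd : ∃ e, t ≤ e ∧ ¬ IsStable p B x E e
      · obtain ⟨e, ⟨hte, hns⟩, hmin⟩ : ∃ e, (t ≤ e ∧ ¬ IsStable p B x E e) ∧
            ∀ s < e, ¬ (t ≤ s ∧ ¬ IsStable p B x E s) :=
          ⟨Nat.find hd, Nat.find_spec hd, fun s hs => Nat.find_min hd hs⟩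
        unfold IsStable at hns
        push Not at hns
        obtain ⟨i, hi, z, hz, hz₁, hz₂⟩ := hns
        refine ⟨e, Finset.mem_insert_of_mem
          (hmerge _ z hz (x i) (hxy i (hED hi)).1 hz₁ hz₂), hte, fun s hts hs => ?_, i, hi, ?_⟩
        · by_contra hs'
          exact hmin s hs ⟨hts, hs'⟩
        · rcases hc _ z (x i) hz₁ with h' | h'
          · exact absurd h' hz₂
          · exact h'.symm.trans hz₁
      -- A tuple that is never unstable is charged to time `N`: at `N + 1` all vertices share one
      -- colour, so it meets the class of the centre.
      · push Not at hd
        exact ⟨N, Finset.mem_insert_self _ _, htN, fun s hs _ => hd s hs, i₀, hi₀,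
          hN (N + 1) (by omega) _ _⟩
    obtain ⟨e, heT, hte, hst, i, hi, hci⟩ := hdeath
    -- Entries of `E` are within `ρ` of the entry `i₀`, hence within `ρ + ρ` of the entry that lies
    -- in the merged class; distances only shrink as colours coarsen.
    have hmem : ∀ j ∈ E, p e (x j) ∈ F e := by
      intro j hj
      refine hFmem e _ (Near.congr_left (Near.coarsen (h.coarsen_le (hte.trans (Nat.le_succ e)))
        ((hnear i hi).symm.trans (hnear j hj))) hci.symm)
    -- Outside `E` the colour of `x i` serves as a default, to keep the whole colour tuple inside `F
    -- e`.
    refine Finset.mem_biUnion.2 ⟨e, heT, Finset.mem_biUnion.2 ⟨E, Finset.mem_univ _,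
      Finset.mem_biUnion.2 ⟨fun j => if j ∈ E then p e (x j) else p e (x i), ?_, ?_⟩⟩⟩
    · rw [Fintype.mem_piFinset]
      intro j
      split_ifs with hj
      · exact hmem j hj
      · exact hmem i hi
    · exact hT' E e _ t hte x y (fun j hj => hxy j (hED hj)) (fun j hj => hcol j (hED hj))
        (fun j hj => by simp [hj]) hst hwE hnE

end Events

/-! ### Traces of tuples on a set of vertices -/

section Traces

variable {V : Type u} {ι : Type*} {μ : Type v} {κ : Type w} {G : SimpleGraph V} {p p' : V → ι}
  {q : ℕ} {A : Set V} {b c : κ → V} {J : Set κ}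

/-- The subtuples of `b` and `c` indexed by `J` have the same game classes over `μ`-tuples
of elements of `A`. -/
def Similar (μ : Type v) (G : SimpleGraph V) (p : V → ι) (q : ℕ) (A : Set V) (b c : κ → V)
    (J : Set κ) : Prop :=
  ∀ (x : μ → V) (D : Set (μ ⊕ κ)), (∀ i, Sum.inl i ∈ D → x i ∈ A) → (∀ j, Sum.inr j ∈ D → j ∈ J) →
    Winning G p q (pairs (Sum.elim x b) (Sum.elim x c) D)

/-- Over `μ`-tuples of elements of `A`, the game class with the entries of `b` outside `J` added is
determined by the class without them. -/
def Simple (μ : Type v) (G : SimpleGraph V) (p : V → ι) (q : ℕ) (A : Set V) (b : κ → V)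
    (J : Set κ) : Prop :=
  ∀ (x y : μ → V) (D : Set (μ ⊕ κ)), (∀ i, Sum.inl i ∈ D → x i ∈ A ∧ y i ∈ A) →
    (∀ j, Sum.inr j ∈ D → j ∈ J) → Winning G p q (pairs (Sum.elim x b) (Sum.elim y b) D) →
      Winning G p q (pairs (Sum.elim x b) (Sum.elim y b) (D ∪ Sum.inr '' Jᶜ))

lemma Similar.coarsen (hp : ∀ x y, p x = p y → p' x = p' y) (h : Similar μ G p q A b c J) :
    Similar μ G p' q A b c J := fun x D h₁ h₂ => (h x D h₁ h₂).coarsen hp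

lemma Similar.symm (h : Similar μ G p q A b c J) : Similar μ G p q A c b J :=
  fun x D h₁ h₂ => (h x D h₁ h₂).pairs_symm

lemma Similar.trans {e : κ → V} (h : Similar μ G p q A b c J) (h' : Similar μ G p q A c e J) :
    Similar μ G p q A b e J := fun x D h₁ h₂ => (h x D h₁ h₂).pairs_trans (h' x D h₁ h₂)

lemma Similar.color (h : Similar μ G p q A b c J) [Nonempty V] {j : κ} (hj : j ∈ J) :
    p (b j) = p (c j) :=
  (h (fun _ => Classical.arbitrary V) {Sum.inr j} (by simp) (by simpa using hj)).pairs_color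
    (i := Sum.inr j) rfl

lemma Similar.transfer (h : Similar μ G p q A b c J) {x y : μ → V} {D : Set (μ ⊕ κ)}
    (hA : ∀ i, Sum.inl i ∈ D → x i ∈ A ∧ y i ∈ A) (hJ : ∀ j, Sum.inr j ∈ D → j ∈ J)
    (hw : Winning G p q (pairs (Sum.elim x b) (Sum.elim y b) D)) :
    Winning G p q (pairs (Sum.elim x c) (Sum.elim y c) D) :=
  ((h x D (fun i hi => (hA i hi).1) hJ).pairs_symm.pairs_trans hw).pairs_trans
    (h y D (fun i hi => (hA i hi).2) hJ)

/-- Indices of `D` outside `J` can be dropped first, since simplicity over `J` restores all of them.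
-/
lemma Simple.insert (h : Simple μ G p q A b J) (i : κ) : Simple μ G p q A b (insert i J) := by
  intro x y D hA hJ hw
  refine (h x y {s ∈ D | ∀ j, s = Sum.inr j → j ∈ J} (fun i hi => hA i hi.1)
    (fun j hj => hj.2 j rfl) (hw.mono (pairs_mono _ _ (Set.sep_subset _ _)))).mono
    (pairs_mono _ _ ?_)
  rintro s (hs | ⟨j, hj, rfl⟩)
  · by_cases h' : ∀ j, s = Sum.inr j → j ∈ J
    · exact Or.inl ⟨hs, h'⟩
    · push Not at h'
      obtain ⟨j, rfl, hj⟩ := h'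
      exact Or.inr ⟨j, hj, rfl⟩
  · exact Or.inr ⟨j, fun hj' => hj (Or.inr hj'), rfl⟩

lemma simple_of_injective (hp : Function.Injective p) : Simple μ G p q A b J := by
  intro x y D hA hJ hw
  refine winning_diagonal q ?_
  rintro _ ⟨i, hi | ⟨j, -, rfl⟩, rfl⟩
  · exact hp (hw.pairs_color hi)
  · rfl

/-- Simplicity survives a merge into the class of `e` that takes place far from the entries
outside `J`. -/
lemma Simple.of_far [Fintype μ] [Fintype κ] {e : V} (h : Simple μ G p q A b J)
    (hp : ∀ x y, p x = p y → p' x = p' y) (hp' : ∀ x y, p' x = p' y → p x = p y ∨ p' x = p' e)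
    (hfar : ∀ j ∉ J, ¬ Near G p' ((Fintype.card (μ ⊕ κ) + 1) * 2 ^ q) e (b j)) :
    Simple μ G p' q A b J := by
  intro x y D hA hJ hw
  obtain ⟨l, hl, hgap⟩ := exists_gap G p' (2 ^ q) e (Sum.elim x b)
  have hout : ∀ j ∉ J, ¬ Near G p' (l * 2 ^ q) e (b j) := fun j hj hn =>
    hfar j hj (hn.mono (Nat.mul_le_mul_right _ (by omega)))
  -- Inside the annulus there is no index outside `J`, so the given position suffices. Outside it,
  -- the position also wins for the finer `p`, where simplicity is available.
  refine Winning.pairs_of_gap (fun i _ => hgap i) (hw.mono (pairs_mono _ _ ?_)) ?_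
  · rintro _ ⟨hi | ⟨j, hj, rfl⟩, hn⟩
    · exact hi
    · exact absurd hn (hout j hj)
  · let O : Set (μ ⊕ κ) := {i ∈ D | ¬ Near G p' (l * 2 ^ q) e (Sum.elim x b i)}
    have hO : Winning G p q (pairs (Sum.elim x b) (Sum.elim y b) O) := by
      refine (hw.mono (pairs_mono _ _ (Set.sep_subset _ _))).refine_of_far hp hp' ?_
      rintro _ ⟨i, hi, rfl⟩ hn
      exact hi.2 (hgap i (hn.mono (Nat.le_mul_of_pos_left _ (Nat.succ_pos l))))
    refine ((h x y O (fun i hi => hA i hi.1) (fun j hj => hJ j hj.1) hO).coarsen hp).mono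
      (pairs_mono _ _ ?_)
    rintro i ⟨hi | hi, hn⟩
    · exact Or.inl ⟨hi, hn⟩
    · exact Or.inr hi

/-- Simplicity is lost only at an event for `A` and the entries inside `J`. -/
lemma Simple.isEvent {p : ℕ → V → ι} {t : ℕ} (hp : ∀ x y, p t x = p t y → p (t + 1) x = p (t + 1) y)
    (h : Simple μ G (p t) q A b J) (h' : ¬ Simple μ G (p (t + 1)) q A b J)
    (hbc : Similar μ G (p t) q A b c J) : IsEvent (μ ⊕ κ) G p q (A ∪ c '' J) t := by
  unfold Simple at h'
  push Not at h'
  obtain ⟨x, y, D, hA, hJ, hw, hn⟩ := h'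
  -- The event is exhibited with `c` in place of `b`, so the possible times depend on the
  -- description and not on `b`.
  refine ⟨Sum.elim x c, Sum.elim y c, D, ?_, (hbc.coarsen hp).transfer hA hJ hw, fun hw' => ?_⟩
  · rintro (i | j) hi
    · exact ⟨Or.inl (hA i hi).1, Or.inl (hA i hi).2⟩
    · exact ⟨Or.inr ⟨j, hJ j hi, rfl⟩, Or.inr ⟨j, hJ j hi, rfl⟩⟩
  · exact hn ((h x y D hA hJ (hbc.symm.transfer hA hJ hw')).coarsen hp)

end Traces

/-- Simple tuples with a prescribed trace on `J` and a prescribed colour of the entry `i` have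
boundedly many traces on `insert i J`. -/
lemma exists_representatives (μ : Type v) (κ : Type w) [Fintype μ] [Fintype κ] (d q : ℕ) : ∃ K : ℕ,
    ∀ (V : Type u) (ι : Type u) (G : SimpleGraph V) (p : V → ι) (A : Set V),
      BoundedLinks G p d → ∀ (J : Set κ) (i : κ) (c : κ → V) (a : ι), i ∉ J →
        ∃ R : Finset (κ → V), R.card ≤ K ∧ ∀ b, Similar μ G p q A b c J →
          Simple μ G p q A b J → p (b i) = a → ∃ e ∈ R, Similar μ G p q A b e (insert i J) := by
  classical
  obtain ⟨K, hK⟩ := exists_code.{u, u} (μ ⊕ κ) d q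
  let ρ := Fintype.card (μ ⊕ κ) * 2 ^ q
  let L := (d + 1) ^ ρ
  let Z := Set (μ ⊕ κ) × (μ → Fin (L + 1)) × Fin K
  refine ⟨Fintype.card (Z → Fin K), fun V ι G p A hd J i c a hi => ?_⟩
  obtain ⟨f, hf⟩ := hK V ι G p hd
  by_cases hv : ∃ v, p v = a
  swap
  · exact ⟨∅, by simp, fun b _ _ hb => absurd ⟨_, hb⟩ hv⟩
  obtain ⟨v, rfl⟩ := hv
  have : Nonempty V := ⟨v⟩
  obtain ⟨F, hF, hF'⟩ := hd.ball ρ v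
  obtain ⟨g, hg⟩ := exists_injOn_fin F hF
  -- representatives of the classes of tuples over `A` near `v`
  let P : Z → (μ → V) → Prop := fun z x => (∀ s, Sum.inl s ∈ z.1 → x s ∈ A ∧ Near G p ρ v (x s) ∧
    g (p (x s)) = z.2.1 s) ∧ f z.1 (Sum.elim x c) = z.2.2
  have hrep : ∀ z, ∃ x, (∃ y, P z y) → P z x := by
    intro z
    by_cases hz : ∃ y, P z y
    · exact ⟨hz.choose, fun _ => hz.choose_spec⟩
    · exact ⟨fun _ => v, fun h => absurd h hz⟩
  choose rep hrep using hrep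
  -- The classes of `b` over finitely many test tuples `rep z`, chosen independently of `b`, are
  -- enough to determine its trace on `insert i J`.
  let code : (κ → V) → Z → Fin K := fun b z =>
    f (z.1 ∪ {Sum.inr i}) (Sum.elim (rep z) b)
  let good : (κ → V) → Prop := fun b =>
    Similar μ G p q A b c J ∧ Simple μ G p q A b J ∧ p (b i) = p v
  have key : ∀ b b', good b → good b' → code b = code b' →
      Similar μ G p q A b b' (insert i J) := by
    rintro b b' ⟨hb, hbs, hbi⟩ ⟨hb', hbs', hbi'⟩ hcode x D hA hJ
    have hbb' := hb.trans hb'.symm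
    obtain ⟨l, hl, hgap⟩ := exists_gap G p (2 ^ q) v (Sum.elim x b)
    have hlρ : l * 2 ^ q ≤ ρ := Nat.mul_le_mul_right _ hl
    let I : Set (μ ⊕ κ) := {s ∈ D | Near G p (l * 2 ^ q) v (Sum.elim x b s) ∧ s ≠ Sum.inr i}
    have hIJ : ∀ j, Sum.inr j ∈ I → j ∈ J := by
      rintro j ⟨hj, -, hne⟩
      rcases hJ j hj with rfl | h
      · exact absurd rfl hne
      · exact h
    refine Winning.pairs_of_gap (c := v) (l := l) (fun s _ => hgap s) ?_ ?_
    -- Near `v`, exchange `x` for its representative: simplicity of `b` and of `b'` carries the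
    -- exchange over to the entry `i`, and the codes compare `b` with `b'` over the representative.
    -- Away from `v` the entry `i` is absent and similarity on `J` suffices.
    · let z : Z := (I, fun s => g (p (x s)), f I (Sum.elim x c))
      have hx : P z x := ⟨fun s hs => ⟨hA s hs.1, hs.2.1.mono hlρ, rfl⟩, rfl⟩
      obtain ⟨hz₁, hz₂⟩ := hrep z ⟨x, hx⟩
      have hAA : ∀ s, Sum.inl s ∈ I → x s ∈ A ∧ rep z s ∈ A := fun s hs =>
        ⟨(hx.1 s hs).1, (hz₁ s hs).1⟩
      have hxc : Winning G p q (pairs (Sum.elim x c) (Sum.elim (rep z) c) I) := by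
        refine hf _ _ _ ?_ hz₂.symm
        rintro (s | j) hs
        · exact hg (hF' _ (hx.1 s hs).2.1) (hF' _ (hz₁ s hs).2.1) (hz₁ s hs).2.2.symm
        · rfl
      have hsub : I ∪ {Sum.inr i} ⊆ I ∪ Sum.inr '' Jᶜ := by
        refine Set.union_subset_union_right _ ?_
        rintro _ rfl
        exact ⟨i, hi, rfl⟩
      have h₁ := (hbs x (rep z) I hAA hIJ (hb.symm.transfer hAA hIJ hxc)).mono
        (pairs_mono _ _ hsub)
      have h₂ := (hbs' x (rep z) I hAA hIJ (hb'.symm.transfer hAA hIJ hxc)).mono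
        (pairs_mono _ _ hsub)
      have h₃ : Winning G p q (pairs (Sum.elim (rep z) b) (Sum.elim (rep z) b')
          (I ∪ {Sum.inr i})) := by
        refine hf _ _ _ ?_ (congrFun hcode z)
        rintro (s | j) hs
        · rfl
        · rcases hs with hs | hs
          · exact hbb'.color (hIJ j hs)
          · obtain rfl : j = i := by simpa using hs
            exact hbi.trans hbi'.symm
      refine ((h₁.pairs_trans h₃).pairs_trans h₂.pairs_symm).mono (pairs_mono _ _ ?_)
      rintro s ⟨hs, hs'⟩
      by_cases hsi : s = Sum.inr i
      · exact Or.inr hsi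
      · exact Or.inl ⟨hs, hs', hsi⟩
    · refine hbb' x _ (fun s hs => hA s hs.1) ?_
      rintro j ⟨hj, hj'⟩
      rcases hJ j hj with rfl | h
      · exact absurd (near_self _ hbi.symm) hj'
      · exact h
  refine ⟨Finset.univ.image fun k => if h : ∃ b, good b ∧ code b = k then h.choose else c,
    Finset.card_image_le.trans_eq Finset.card_univ, fun b h₁ h₂ h₃ => ?_⟩
  have h : ∃ b', good b' ∧ code b' = code b := ⟨b, ⟨h₁, h₂, h₃⟩, rfl⟩
  refine ⟨_, Finset.mem_image.2 ⟨code b, Finset.mem_univ _, rfl⟩, ?_⟩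
  simp only [h, dite_true]
  exact key _ _ ⟨h₁, h₂, h₃⟩ h.choose_spec.1 h.choose_spec.2.symm

/-! ### Counting the descriptions of tuples -/

/-- Every tuple `b` is described, at some time `t`, by the trace of a subtuple with `n` entries,
over which the rest of `b` is simple; there are at most `K * |A| ^ n` descriptions. -/
lemma exists_descriptions (μ : Type v) (κ : Type w) [Fintype μ] [Fintype κ] (d q n : ℕ)
    (hn : n ≤ Fintype.card κ) : ∃ K : ℕ, ∀ (V : Type u) [Finite V] (ι : Type u) (G : SimpleGraph V)
      (p : ℕ → V → ι), IsContraction G d p → ∀ A : Finset V, A.Nonempty →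
        ∃ R : Finset (ℕ × Finset κ × (κ → V)), R.card ≤ K * A.card ^ n ∧
          ∀ b : κ → V, ∃ t J c, (t, J, c) ∈ R ∧ J.card = n ∧ Similar μ G (p t) q A b c J ∧
            Simple μ G (p t) q A b J := by
  classical
  induction n with
  | zero =>
    refine ⟨1, fun V _ ι G p h A hA => ?_⟩
    obtain ⟨v, -⟩ := hA
    refine ⟨{(0, ∅, fun _ => v)}, by simp, fun b => ⟨0, ∅, fun _ => v, by simp, by simp, ?_,
      simple_of_injective h.injective⟩⟩
    intro x D _ hJ
    refine winning_diagonal q ?_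
    rintro _ ⟨i | j, hi, rfl⟩
    · rfl
    · simpa using hJ j hi
  | succ n ih =>
    obtain ⟨K₁, hK₁⟩ := ih (by omega)
    obtain ⟨K₂, hK₂⟩ := exists_cover_events.{u, u} (μ ⊕ κ) d q
    obtain ⟨K₃, hK₃⟩ := exists_representatives.{u} μ κ d q
    let k := Fintype.card κ
    let ρ := (Fintype.card (μ ⊕ κ) + 1) * 2 ^ q
    let L := (d + 1) ^ ρ + 2
    -- Each old description is extended by a time, an index `i` (`k` choices), a colour of `b i`
    -- (`L`) and a trace (`K₃`). The times are the events over at most `(k + 1) * A.card` vertices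
    -- and one final time.
    refine ⟨K₁ * ((K₂ * (k + 1) + 1) * (k * (L * K₃))), fun V _ ι G p h A hA => ?_⟩
    obtain ⟨N, hN⟩ := h.eventually_const
    choose c hc hF using h.exists_center
    choose F hFcard hFmem using fun t => hF t ρ
    obtain ⟨R, hR, hR'⟩ := hK₁ V ι G p h A hA
    -- the times at which the description may have to be extended
    have htimes : ∀ r : ℕ × Finset κ × (κ → V), ∃ T : Finset ℕ,
        T.card ≤ (K₂ * (k + 1) + 1) * A.card ∧ max r.1 N ∈ T ∧
        ∀ t, IsEvent (μ ⊕ κ) G p q (A ∪ r.2.2 '' r.2.1) t → t ∈ T := by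
      intro r
      obtain ⟨T, hT, hT'⟩ := hK₂ V ι G p h (A ∪ r.2.1.image r.2.2)
        (hA.mono Finset.subset_union_left)
      refine ⟨insert (max r.1 N) T, ?_, Finset.mem_insert_self _ _, fun t ht =>
        Finset.mem_insert_of_mem (hT' t (by simpa using ht))⟩
      have h₁ := Finset.card_insert_le (max r.1 N) T
      have h₂ : (A ∪ r.2.1.image r.2.2).card ≤ A.card + k :=
        (Finset.card_union_le _ _).trans (Nat.add_le_add_left
          (Finset.card_image_le.trans (Finset.card_le_univ _)) _)
      have h₃ := hA.card_pos
      calc _ ≤ K₂ * (A ∪ r.2.1.image r.2.2).card + 1 := by omega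
        _ ≤ K₂ * (A.card + k * A.card) + 1 * A.card := by
          gcongr
          · exact h₂.trans (Nat.add_le_add_left (Nat.le_mul_of_pos_right _ h₃) _)
          · omega
        _ = _ := by ring
    choose T hTcard hTmax hTevent using htimes
    have hreps : ∀ (t : ℕ) (J : Finset κ) (i : κ) (e : κ → V) (a : ι),
        ∃ S : Finset (κ → V), S.card ≤ K₃ ∧ (i ∉ J → ∀ b, Similar μ G (p t) q A b e J →
          Simple μ G (p t) q A b J → p t (b i) = a →
            ∃ e' ∈ S, Similar μ G (p t) q A b e' (insert i J)) := by
      intro t J i e a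
      by_cases hi : i ∈ J
      · exact ⟨∅, by simp, fun h => absurd hi h⟩
      · obtain ⟨S, hS, hS'⟩ := hK₃ V ι G (p t) A (h.links t) J i e a (by simpa using hi)
        exact ⟨S, hS, fun _ => hS'⟩
    choose S hS hS' using hreps
    refine ⟨R.biUnion fun r => (T r).biUnion fun t => Finset.univ.biUnion fun i =>
      (F t).biUnion fun a => (S t r.2.1 i r.2.2 a).image fun e => (t, insert i r.2.1, e), ?_, ?_⟩
    · have hcard : ∀ r ∈ R, ((T r).biUnion fun t => Finset.univ.biUnion fun i =>
          (F t).biUnion fun a => (S t r.2.1 i r.2.2 a).image fun e =>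
            ((t, insert i r.2.1, e) : ℕ × Finset κ × (κ → V))).card ≤
            (K₂ * (k + 1) + 1) * A.card * (k * (L * K₃)) := by
        intro r _
        refine (Finset.card_biUnion_le_card_mul _ _ (k * (L * K₃)) fun t _ => ?_).trans
          (Nat.mul_le_mul_right _ (hTcard r))
        refine Finset.card_biUnion_le_card_mul _ _ _ fun i _ => ?_
        refine (Finset.card_biUnion_le_card_mul _ _ K₃ fun a _ => ?_).trans
          (Nat.mul_le_mul_right _ (hFcard t))
        exact Finset.card_image_le.trans (hS _ _ _ _ _)
      refine (Finset.card_biUnion_le_card_mul _ _ _ hcard).trans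
        ((Nat.mul_le_mul_right _ hR).trans_eq ?_)
      ring
    · intro b
      obtain ⟨t₀, J, e, hr, hJ, hsim, hsimple⟩ := hR' b
      -- Take the last time before simplicity is first lost; if it is never lost, take `max t₀ N`,
      -- after which everything lies in one class.
      have hstep : ∃ t ≥ t₀, t ∈ T (t₀, J, e) ∧ Simple μ G (p t) q A b J ∧
          ∃ i ∉ J, Near G (p (t + 1)) ρ (c t) (b i) := by
        by_cases hall : ∀ t ≥ t₀, Simple μ G (p t) q A b J
        · refine ⟨max t₀ N, le_max_left _ _, hTmax (t₀, J, e), hall _ (le_max_left _ _), ?_⟩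
          obtain ⟨i, hi⟩ : ∃ i, i ∉ J := by
            by_contra! hcon
            have := Finset.card_eq_iff_eq_univ J |>.2 (by ext; simp [hcon])
            omega
          exact ⟨i, hi, near_self _ (hN _ (by omega) _ _)⟩
        · push Not at hall
          obtain ⟨s, ⟨hs, hs'⟩, hmin⟩ : ∃ s, (s ≥ t₀ ∧ ¬ Simple μ G (p s) q A b J) ∧
              ∀ t < s, ¬ (t ≥ t₀ ∧ ¬ Simple μ G (p t) q A b J) :=
            ⟨Nat.find hall, Nat.find_spec hall, fun t ht => Nat.find_min hall ht⟩
          have hne : s ≠ t₀ := by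
            rintro rfl
            exact hs' hsimple
          obtain ⟨t, rfl⟩ : ∃ t, s = t + 1 := ⟨s - 1, by omega⟩
          have ht : t₀ ≤ t := by omega
          have hts : Simple μ G (p t) q A b J := by
            by_contra hcon
            exact hmin t (Nat.lt_succ_self t) ⟨ht, hcon⟩
          refine ⟨t, ht, hTevent (t₀, J, e) t (hts.isEvent (h.coarsen t) hs'
            (hsim.coarsen (h.coarsen_le ht))), hts, ?_⟩
          by_contra! hcon
          exact hs' (hts.of_far (h.coarsen t) (hc t) fun j hj => hcon j (by simpa using hj))
      obtain ⟨t, ht, htT, hts, i, hi, hnear⟩ := hstep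
      obtain ⟨e', he', hsim'⟩ := hS' t J i e (p t (b i)) hi b (hsim.coarsen (h.coarsen_le ht)) hts rfl
      refine ⟨t, insert i J, e', ?_, by rw [Finset.card_insert_of_notMem hi, hJ], ?_, ?_⟩
      · simp only [Finset.mem_biUnion]
        exact ⟨_, hr, t, htT, i, Finset.mem_univ _, _, hFmem t _ hnear,
          Finset.mem_image.2 ⟨e', he', rfl⟩⟩
      · simpa using hsim'
      · simpa using hts.insert i

/-! ### First-order formulas and the game -/

/-- The easy half of the Ehrenfeucht–Fraïssé theorem: a quantifier costs one round. Colours only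
restrict Duplicator, so any colouring is allowed. -/
lemma exists_realize_iff {γ : Type w} {n : ℕ} (φ : Language.graph.BoundedFormula γ n) : ∃ q : ℕ,
    ∀ (V : Type u) (ι : Type v) (G : SimpleGraph V) (p : V → ι) (x y : γ ⊕ Fin n → V),
      Winning G p q (pairs x y Set.univ) →
        (@Language.BoundedFormula.Realize _ _ G.structure _ _ φ (x ∘ Sum.inl) (x ∘ Sum.inr) ↔
          @Language.BoundedFormula.Realize _ _ G.structure _ _ φ (y ∘ Sum.inl) (y ∘ Sum.inr)) := by
  have hterm : ∀ {m : ℕ} (t : Language.graph.Term (γ ⊕ Fin m)), ∃ i, t = Language.Term.var i := by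
    rintro m (i | ⟨f, _⟩)
    · exact ⟨i, rfl⟩
    · exact isEmptyElim f
  induction φ with
  | falsum => exact ⟨0, fun V ι G p x y _ => Iff.rfl⟩
  | equal t₁ t₂ =>
    obtain ⟨i, rfl⟩ := hterm t₁
    obtain ⟨j, rfl⟩ := hterm t₂
    refine ⟨0, fun V ι G p x y h => ?_⟩
    simp only [Language.BoundedFormula.Realize, Language.Term.realize, Sum.elim_comp_inl_inr]
    exact ((h _ ⟨i, trivial, rfl⟩).2 _ ⟨j, trivial, rfl⟩).1
  | rel R ts =>
    cases R
    obtain ⟨i, hi⟩ := hterm (ts 0)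
    obtain ⟨j, hj⟩ := hterm (ts 1)
    refine ⟨0, fun V ι G p x y h => ?_⟩
    simp only [Language.BoundedFormula.Realize, Language.Structure.RelMap, hi, hj,
      Language.Term.realize, Sum.elim_comp_inl_inr]
    exact ((h _ ⟨i, trivial, rfl⟩).2 _ ⟨j, trivial, rfl⟩).2
  | imp φ ψ hφ hψ =>
    obtain ⟨q₁, h₁⟩ := hφ
    obtain ⟨q₂, h₂⟩ := hψ
    refine ⟨max q₁ q₂, fun V ι G p x y h => ?_⟩
    exact imp_congr (h₁ V ι G p x y (h.of_le (le_max_left _ _)))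
      (h₂ V ι G p x y (h.of_le (le_max_right _ _)))
  | @all m φ hφ =>
    obtain ⟨q, hq⟩ := hφ
    refine ⟨q + 1, fun V ι G p x y h => ?_⟩
    have key : ∀ a b, Winning G p q (insert (a, b) (pairs x y Set.univ)) →
        (@Language.BoundedFormula.Realize _ _ G.structure _ _ φ (x ∘ Sum.inl)
            (Fin.snoc (x ∘ Sum.inr) a) ↔
          @Language.BoundedFormula.Realize _ _ G.structure _ _ φ (y ∘ Sum.inl)
            (Fin.snoc (y ∘ Sum.inr) b)) := by
      intro a b hab
      refine hq V ι G p (Sum.elim (x ∘ Sum.inl) (Fin.snoc (x ∘ Sum.inr) a))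
        (Sum.elim (y ∘ Sum.inl) (Fin.snoc (y ∘ Sum.inr) b)) (hab.mono ?_)
      rintro _ ⟨i | i, -, rfl⟩
      · exact Or.inr ⟨Sum.inl i, trivial, rfl⟩
      · refine Fin.lastCases ?_ (fun i => ?_) i
        · exact Or.inl (by simp)
        · exact Or.inr ⟨Sum.inr i, trivial, by simp⟩
    constructor
    · intro hx b
      obtain ⟨a, ha⟩ := h.2.2 b
      exact (key a b ha).1 (hx a)
    · intro hy a
      obtain ⟨b, hb⟩ := h.2.1 a
      exact (key a b hb).2 (hy b)

/-! ### Contraction sequences of bounded width -/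

section Sequences

variable {V : Type u} [Fintype V] [DecidableEq V]

/-- The part of a vertex at each time, constant after the end of the sequence. -/
noncomputable def ContractionSequence.color [Nonempty V] (S : ContractionSequence V) (t : ℕ)
    (x : V) : Finset V :=
  (S.partition ⟨min t (Fintype.card V - 1), by have := Fintype.card_pos (α := V); omega⟩).part x

lemma boundedLinks_part (G : SimpleGraph V) (P : Finpartition (Finset.univ : Finset V)) {d : ℕ}
    (h : ∀ A, Set.ncard {B | (impurityGraph G P).Adj A B} ≤ d) : BoundedLinks G P.part d := by
  classical
  intro x
  let X : {A : Finset V // A ∈ P.parts} := ⟨P.part x, P.part_mem.2 (Finset.mem_univ x)⟩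
  refine ⟨insert (P.part x) (((Set.toFinite {B | (impurityGraph G P).Adj X B}).toFinset).image
    Subtype.val), ?_, fun y hy => ?_⟩
  · refine (Finset.card_insert_le _ _).trans (Nat.succ_le_succ (Finset.card_image_le.trans ?_))
    rw [← Set.ncard_eq_toFinset_card]
    exact h X
  · by_cases hxy : P.part y = P.part x
    · exact hxy ▸ Finset.mem_insert_self _ _
    · rcases hy with hy | ⟨x₁, x₂, y₁, y₂, hx₁, hx₂, hy₁, hy₂, h₁, h₂⟩
      · exact absurd hy.symm hxy
      have hmem : ∀ z z', P.part z = P.part z' → z ∈ P.part z' := fun z z' hz =>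
        hz ▸ P.mem_part_self.2 (Finset.mem_univ z)
      refine Finset.mem_insert_of_mem (Finset.mem_image.2
        ⟨⟨P.part y, P.part_mem.2 (Finset.mem_univ y)⟩, ?_, rfl⟩)
      simp only [Set.Finite.mem_toFinset, Set.mem_ofPred_eq]
      refine ⟨fun heq => hxy (congrArg Subtype.val heq).symm, fun hc => ?_, fun hc => ?_⟩
      · exact h₂ (hc x₂ (hmem _ _ hx₂) y₂ (hmem _ _ hy₂))
      · exact hc x₁ (hmem _ _ hx₁) y₁ (hmem _ _ hy₁) h₁

lemma ContractionSequence.isContraction [Nonempty V] (S : ContractionSequence V)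
    (G : SimpleGraph V) {d : ℕ} (hd : S.width G ≤ d) : IsContraction G d S.color := by
  classical
  have hpos := Fintype.card_pos (α := V)
  have hstep : ∀ t, (∀ x, S.color (t + 1) x = S.color t x) ∨
      ∃ P Q : Finpartition (Finset.univ : Finset V), S.color t = P.part ∧
        S.color (t + 1) = Q.part ∧ ∃ A ∈ P.parts, ∃ B ∈ P.parts, A ≠ B ∧
          Q.parts = insert (A ∪ B) ((P.parts.erase A).erase B) := by
    intro t
    by_cases ht : t + 1 < Fintype.card V
    · refine Or.inr ⟨S.partition ⟨t, by omega⟩, S.partition ⟨t + 1, ht⟩, ?_, ?_, S.step t ht⟩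
      · funext x
        unfold ContractionSequence.color
        congr 3
        omega
      · funext x
        unfold ContractionSequence.color
        congr 3
        omega
    · refine Or.inl fun x => ?_
      unfold ContractionSequence.color
      congr 3
      omega
  refine ⟨?_, ?_, ?_, ?_, Fintype.card V - 1, ?_⟩
  · intro x y hxy
    have h0 : S.color 0 = (⊥ : Finpartition (Finset.univ : Finset V)).part := by
      funext x
      unfold ContractionSequence.color
      rw [← S.first hpos]
      congr 3
    rw [h0] at hxy
    have hx : ∀ x : V, (⊥ : Finpartition (Finset.univ : Finset V)).part x = {x} := fun x =>
      Finpartition.part_eq_of_mem _ (Finpartition.mem_bot_iff.2 ⟨x, Finset.mem_univ x, rfl⟩)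
        (Finset.mem_singleton_self x)
    rw [hx, hx] at hxy
    exact Finset.singleton_injective hxy
  · intro t x y hxy
    rcases hstep t with h | ⟨P, Q, hP, hQ, A, hA, B, hB, hAB, hparts⟩
    · rw [h, h, hxy]
    rw [hP] at hxy
    rw [hQ]
    have hx : x ∈ P.part x := P.mem_part_self.2 (Finset.mem_univ x)
    have hy : y ∈ P.part x := hxy ▸ P.mem_part_self.2 (Finset.mem_univ y)
    by_cases hXA : P.part x = A ∨ P.part x = B
    · have hsub : P.part x ⊆ A ∪ B := by
        rcases hXA with h | h <;> rw [h]
        · exact Finset.subset_union_left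
        · exact Finset.subset_union_right
      have hmem : A ∪ B ∈ Q.parts := hparts ▸ Finset.mem_insert_self _ _
      rw [Q.part_eq_of_mem hmem (hsub hx), Q.part_eq_of_mem hmem (hsub hy)]
    · push Not at hXA
      have hmem : P.part x ∈ Q.parts := by
        rw [hparts]
        exact Finset.mem_insert_of_mem (Finset.mem_erase.2 ⟨hXA.2, Finset.mem_erase.2
          ⟨hXA.1, P.part_mem.2 (Finset.mem_univ x)⟩⟩)
      rw [Q.part_eq_of_mem hmem hx, Q.part_eq_of_mem hmem hy]
  · intro t
    rcases hstep t with h | ⟨P, Q, hP, hQ, A, hA, B, hB, hAB, hparts⟩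
    · obtain ⟨v⟩ := ‹Nonempty V›
      exact ⟨v, v, fun x y hxy => Or.inl (by rwa [h, h] at hxy)⟩
    rw [hP, hQ]
    obtain ⟨a, ha⟩ := P.nonempty_of_mem_parts hA
    obtain ⟨b, hb⟩ := P.nonempty_of_mem_parts hB
    refine ⟨a, b, fun x y hxy => ?_⟩
    have hx : x ∈ Q.part x := Q.mem_part_self.2 (Finset.mem_univ x)
    have hy : y ∈ Q.part x := hxy ▸ Q.mem_part_self.2 (Finset.mem_univ y)
    have hmem : Q.part x ∈ Q.parts := Q.part_mem.2 (Finset.mem_univ x)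
    rw [hparts, Finset.mem_insert] at hmem
    rcases hmem with h | h
    · refine Or.inr ⟨?_, ?_⟩
      · rw [h, Q.part_eq_of_mem (hparts ▸ Finset.mem_insert_self _ _)
          (Finset.mem_union_left B ha)]
      · rw [P.part_eq_of_mem hA ha, P.part_eq_of_mem hB hb]
        rw [h, Finset.mem_union] at hx
        exact hx.imp (P.part_eq_of_mem hA) (P.part_eq_of_mem hB)
    · have h' := Finset.mem_of_mem_erase (Finset.mem_of_mem_erase h)
      exact Or.inl (by rw [P.part_eq_of_mem h' hx, P.part_eq_of_mem h' hy])
  · intro t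
    refine boundedLinks_part G _ fun A => ?_
    refine le_trans ?_ ((Finset.le_sup (f := fun t => (impurityGraph G (S.partition t)).maxDegree)
      (Finset.mem_univ ⟨min t (Fintype.card V - 1), by omega⟩)).trans hd)
    refine le_trans (le_of_eq ?_) (SimpleGraph.degree_le_maxDegree _ A)
    rw [← SimpleGraph.card_neighborFinset_eq_degree, Set.ncard_eq_toFinset_card']
    congr 1
  · intro t ht x y
    unfold ContractionSequence.color
    have hl := S.last ⟨min t (Fintype.card V - 1), by omega⟩ (by simp only; omega)
    have hmem : (Finset.univ : Finset V) ∈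
        (S.partition ⟨min t (Fintype.card V - 1), by omega⟩).parts := by
      rw [hl]
      exact Finset.mem_singleton_self _
    rw [Finpartition.part_eq_of_mem _ hmem (Finset.mem_univ x),
      Finpartition.part_eq_of_mem _ hmem (Finset.mem_univ y)]

/-- Contractions of a vertex set along an enumeration. -/
lemma nonempty_contractionSequence (V : Type u) [Fintype V] [DecidableEq V] :
    Nonempty (ContractionSequence V) := by
  classical
  let e := Fintype.equivFin V
  -- At time `t` the vertices with index at most `t` form one part and the others are singletons;
  -- `max (e x) t` labels the parts.
  let cls : ℕ → V → Finset V := fun t x =>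
    Finset.univ.filter fun y => max (e x : ℕ) t = max (e y : ℕ) t
  let P : ℕ → Finpartition (Finset.univ : Finset V) := fun t =>
    Finpartition.ofSetoid (Setoid.ker fun x => max (e x : ℕ) t)
  have hP : ∀ t Z, Z ∈ (P t).parts ↔ ∃ x, cls t x = Z := by
    intro t Z
    simp [P, Finpartition.ofSetoid, Finpartition.ofSetSetoid, cls]
  have hle : ∀ t x, (e x : ℕ) ≤ t → cls t x = Finset.univ.filter fun y => (e y : ℕ) ≤ t := by
    intro t x hx
    ext y
    simp only [cls, Finset.mem_filter, Finset.mem_univ, true_and]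
    omega
  have hlt : ∀ t x, t < (e x : ℕ) → cls t x = {x} := by
    intro t x hx
    ext y
    simp only [cls, Finset.mem_filter, Finset.mem_univ, true_and, Finset.mem_singleton]
    constructor
    · intro h
      exact e.injective (Fin.ext (by omega))
    · rintro rfl
      rfl
  refine ⟨⟨fun t => P t, fun h => ?_, fun t ht => ?_, fun t h => ?_⟩⟩
  · ext Z
    simp only [hP, Finpartition.mem_bot_iff, Finset.mem_univ, true_and]
    refine exists_congr fun x => ?_
    suffices cls 0 x = {x} by rw [this]
    rcases Nat.eq_zero_or_pos (e x : ℕ) with hx | hx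
    · rw [hle 0 x hx.le]
      ext y
      simp only [Finset.mem_filter, Finset.mem_univ, true_and, Finset.mem_singleton]
      constructor
      · intro h
        exact e.injective (Fin.ext (by omega))
      · rintro rfl
        omega
    · exact hlt 0 x hx
  · have hall : ∀ x, cls t x = Finset.univ := by
      intro x
      rw [hle t x (by omega)]
      ext y
      simp only [Finset.mem_filter, Finset.mem_univ, true_and, iff_true]
      omega
    ext Z
    simp only [hP, hall, Finset.mem_singleton]
    exact ⟨fun ⟨_, h⟩ => h.symm, fun h => ⟨e.symm t, h.symm⟩⟩
  · let x₀ := e.symm ⟨t, by omega⟩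
    let x₁ := e.symm ⟨t + 1, h⟩
    have hx₀ : (e x₀ : ℕ) = t := by simp [x₀]
    have hx₁ : (e x₁ : ℕ) = t + 1 := by simp [x₁]
    have h₀ := hle t x₀ hx₀.le
    have h₁ := hlt t x₁ (by omega)
    have hunion : cls t x₀ ∪ cls t x₁ = Finset.univ.filter fun y => (e y : ℕ) ≤ t + 1 := by
      rw [h₀, h₁]
      ext y
      have hy : y = x₁ ↔ (e y : ℕ) = t + 1 := by
        rw [← hx₁]
        exact ⟨fun h => by rw [h], fun h => e.injective (Fin.ext h)⟩
      simp only [Finset.mem_union, Finset.mem_filter, Finset.mem_univ, true_and,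
        Finset.mem_singleton, hy]
      omega
    refine ⟨cls t x₀, (hP _ _).2 ⟨x₀, rfl⟩, cls t x₁, (hP _ _).2 ⟨x₁, rfl⟩, fun heq => ?_, ?_⟩
    · have : x₁ ∈ cls t x₀ := heq ▸ h₁ ▸ Finset.mem_singleton_self _
      rw [h₀] at this
      simp only [Finset.mem_filter, Finset.mem_univ, true_and] at this
      omega
    · rw [hunion]
      ext Z
      simp only [hP, Finset.mem_insert, Finset.mem_erase]
      constructor
      · rintro ⟨x, rfl⟩
        rcases Nat.lt_or_ge (t + 1) (e x : ℕ) with hx | hx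
        · refine Or.inr ⟨?_, ?_, x, ?_⟩
          · rw [hlt _ x hx, h₁]
            intro heq
            rw [Finset.singleton_injective heq] at hx
            omega
          · rw [hlt _ x hx, h₀]
            intro heq
            have : x ∈ Finset.univ.filter fun y => (e y : ℕ) ≤ t :=
              heq ▸ Finset.mem_singleton_self _
            simp only [Finset.mem_filter, Finset.mem_univ, true_and] at this
            omega
          · rw [hlt _ x hx, hlt _ x (by omega)]
        · exact Or.inl (hle _ x hx)
      · rintro (rfl | ⟨hZ₁, hZ₀, x, rfl⟩)
        · exact ⟨x₁, hle _ _ hx₁.le⟩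
        · refine ⟨x, ?_⟩
          have hx : t < (e x : ℕ) := by
            by_contra hx
            exact hZ₀ (by rw [hle t x (by omega), h₀])
          have hx' : (e x : ℕ) ≠ t + 1 := by
            intro hx'
            obtain rfl : x = x₁ := e.injective (Fin.ext (by omega))
            exact hZ₁ rfl
          rw [hlt _ x hx, hlt _ x (by omega)]

/-- Every contraction sequence has width 0 here, but one must exist, since the infimum over none
would be `⊤`. -/
lemma twinWidth_bot (V : Type u) [Fintype V] [DecidableEq V] :
    twinWidth (⊥ : SimpleGraph V) = 0 := by
  classical
  obtain ⟨S⟩ := nonempty_contractionSequence V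
  refine le_antisymm ((iInf_le _ S).trans ?_) bot_le
  have : S.width (⊥ : SimpleGraph V) = 0 := by
    refine Nat.le_zero.1 (Finset.sup_le fun t _ => ?_)
    refine SimpleGraph.maxDegree_le_of_forall_degree_le _ _ fun A => ?_
    rw [Nat.le_zero, SimpleGraph.degree, Finset.card_eq_zero, Finset.eq_empty_iff_forall_notMem]
    intro B hB
    rw [SimpleGraph.mem_neighborFinset] at hB
    exact hB.2.2 fun a _ b _ h => h
  simp [this]

end Sequences

/-! ### The bounds on the number of definable sets -/

lemma ncard_stoneSpace_le {α : Type v} {β : Type w} [Fintype α] [Fintype β] (d : ℕ)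
    (φ : Language.graph.Formula (α ⊕ β)) : ∃ C : ℕ, ∀ (V : Type u) [Fintype V] [DecidableEq V]
      (G : SimpleGraph V) (A : Finset V), A.Nonempty → twinWidth G ≤ (d : ℕ∞) →
        (stoneSpace G φ A).ncard ≤ C * A.card ^ Fintype.card β := by
  classical
  obtain ⟨q, hq⟩ := exists_realize_iff.{u, u} φ
  obtain ⟨K, hK⟩ := exists_descriptions.{u} α β d q (Fintype.card β) le_rfl
  refine ⟨K, fun V _ _ G A hA hG => ?_⟩
  have : Nonempty V := ⟨hA.choose⟩
  obtain ⟨S, hS⟩ : ∃ S : ContractionSequence V, S.width G ≤ d := by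
    have hlt : twinWidth G < ((d + 1 : ℕ) : ℕ∞) := hG.trans_lt (by exact_mod_cast Nat.lt_succ_self d)
    obtain ⟨S, hS⟩ := iInf_lt_iff.1 hlt
    exact ⟨S, Nat.lt_succ_iff.1 (by exact_mod_cast hS)⟩
  obtain ⟨R, hR, hR'⟩ := hK V (Finset V) G S.color (S.isContraction G hS) A hA
  refine le_trans ?_ hR
  have hsub : stoneSpace G φ A ⊆ (fun r : ℕ × Finset β × (β → V) => definedSet G φ A r.2.2) '' R := by
    rintro _ ⟨b, rfl⟩
    obtain ⟨t, J, c, hr, hJ, hsim, -⟩ := hR' b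
    -- A subtuple with `Fintype.card β` entries is all of `b`, so similarity now compares `b` with
    -- `c` entirely.
    obtain rfl := (Finset.card_eq_iff_eq_univ J).1 hJ
    refine ⟨_, hr, ?_⟩
    ext a
    refine and_congr_right fun ha => ?_
    have hw := hsim a Set.univ (fun i _ => ha i) (fun j _ => by simp)
    have key := hq V (Finset V) G (S.color t) (Sum.elim (Sum.elim a b) default)
      (Sum.elim (Sum.elim a c) default) (hw.mono (by
        rintro _ ⟨i | i, -, rfl⟩
        · exact ⟨i, trivial, rfl⟩
        · exact i.elim0))
    exact key.symm
  exact (Set.ncard_le_ncard hsub (Set.toFinite _)).trans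
    ((Set.ncard_image_le (Set.toFinite _)).trans_eq (Set.ncard_coe_finset R))

/-- For `b` with entries in `A`, constant tuples show that the defined set determines the set of
entries of `b`. So each set comes from at most `|β| ^ |β|` tuples over `A`. -/
lemma exists_le_ncard_stoneSpace_bot {α : Type v} {β : Type w} [Fintype β] [Nonempty α] :
    ∃ φ : Language.graph.Formula (α ⊕ β), ∀ (V : Type u) [Finite V] (A : Finset V),
      A.card ^ Fintype.card β ≤ Fintype.card β ^ Fintype.card β *
        (stoneSpace (⊥ : SimpleGraph V) φ A).ncard := by
  classical
  obtain ⟨i₀⟩ := ‹Nonempty α›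
  let φ : Language.graph.Formula (α ⊕ β) := Language.BoundedFormula.iSup fun j : β =>
    Language.Term.equal (Language.Term.var (Sum.inl i₀)) (Language.Term.var (Sum.inr j))
  refine ⟨φ, fun V _ A => ?_⟩
  have hφ : ∀ (a : α → V) (b : β → V), @Language.Formula.Realize _ _
      (⊥ : SimpleGraph V).structure _ φ (Sum.elim a b) ↔ ∃ j, a i₀ = b j := by
    intro a b
    let _ := (⊥ : SimpleGraph V).structure
    rw [Language.Formula.Realize, Language.BoundedFormula.realize_iSup]
    refine exists_congr fun j => ?_
    exact Language.Formula.realize_equal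
  have hfin : (stoneSpace (⊥ : SimpleGraph V) φ A).Finite := Set.finite_range _
  have hcard := Finset.card_le_mul_card_image_of_maps_to
    (s := Fintype.piFinset fun _ : β => A) (t := hfin.toFinset)
    (f := fun b => definedSet (⊥ : SimpleGraph V) φ A b)
    (fun b _ => by simp [stoneSpace]) (Fintype.card β ^ Fintype.card β) (by
      intro Z _
      rcases Finset.eq_empty_or_nonempty ((Fintype.piFinset fun _ : β => A).filter fun b =>
        definedSet (⊥ : SimpleGraph V) φ A b = Z) with h | ⟨b, hb⟩
      · simp [h]
      rw [Finset.mem_filter] at hb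
      refine (Finset.card_le_card (t := Fintype.piFinset fun _ : β =>
        Finset.univ.image b) ?_).trans ?_
      · intro b' hb'
        rw [Finset.mem_filter, Fintype.mem_piFinset] at hb'
        rw [Fintype.mem_piFinset]
        intro j
        have hmem : (fun _ => b' j) ∈ definedSet (⊥ : SimpleGraph V) φ A b' :=
          ⟨fun _ => hb'.1 j, (hφ _ _).2 ⟨j, rfl⟩⟩
        rw [hb'.2, ← hb.2] at hmem
        obtain ⟨j', hj'⟩ := (hφ _ _).1 hmem.2
        exact Finset.mem_image.2 ⟨j', Finset.mem_univ _, hj'.symm⟩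
      · rw [Fintype.card_piFinset, Finset.prod_const, Finset.card_univ]
        exact Nat.pow_le_pow_left (Finset.card_image_le.trans_eq Finset.card_univ) _)
  rw [Fintype.card_piFinset, Finset.prod_const, Finset.card_univ,
    ← Set.ncard_eq_toFinset_card _ hfin] at hcard
  exact hcard

end TwinWidth

theorem theorem1p3 {α : Type v} {β : Type w} [Fintype α] [Fintype β] :
    -- the upper bound, with a constant that depends on `d` and `φ` only
    (∀ (d : ℕ) (φ : Language.graph.Formula (α ⊕ β)), ∃ C : ℕ,
      ∀ (V : Type u) [Fintype V] [DecidableEq V] (G : SimpleGraph V) (A : Finset V),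
        A.Nonempty → TwinWidth.twinWidth G ≤ (d : ℕ∞) →
          (TwinWidth.stoneSpace G φ A).ncard ≤ C * A.card ^ Fintype.card β) ∧
    -- optimality, already for edgeless graphs (which have twin-width 0)
    (Nonempty α → ∃ (φ : Language.graph.Formula (α ⊕ β)) (c : ℝ), 0 < c ∧
      ∀ (V : Type u) [Fintype V] [DecidableEq V] (A : Finset V),
        TwinWidth.twinWidth (⊥ : SimpleGraph V) = 0 ∧
          c * (A.card : ℝ) ^ Fintype.card β ≤
            ((TwinWidth.stoneSpace (⊥ : SimpleGraph V) φ A).ncard : ℝ)) := by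
  refine ⟨TwinWidth.ncard_stoneSpace_le, fun _ => ?_⟩
  obtain ⟨φ, hφ⟩ := TwinWidth.exists_le_ncard_stoneSpace_bot (α := α) (β := β)
  -- For empty `β` this rests on `0 ^ 0 = 1`.
  have hpos : 0 < Fintype.card β ^ Fintype.card β := by
    rcases Nat.eq_zero_or_pos (Fintype.card β) with h | h
    · simp [h]
    · positivity
  have hpos' : (0 : ℝ) < ((Fintype.card β ^ Fintype.card β : ℕ) : ℝ) := by exact_mod_cast hpos
  refine ⟨φ, ((Fintype.card β ^ Fintype.card β : ℕ) : ℝ)⁻¹, inv_pos.2 hpos', fun V _ _ A =>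
    ⟨TwinWidth.twinWidth_bot V, ?_⟩⟩
  rw [inv_mul_le_iff₀ hpos']
  exact_mod_cast hφ V A
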